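/- Corollary 5.2. For every real number $\beta$ there is a constant $C_\beta>0$, depending only on $\beta$, such that the following holds for every integer $n\ge 1$ with $n<\beta$. Let $\mu$ be a probability measure on $\mathbb{R}^n$ with density $p(x)=V(x)^{-\beta}$ with respect to Lebesgue measure, where $V:\mathbb{R}^n\to(0,+\infty]$ is an arbitrary positive convex function, possibly taking the value $+\infty$ (where $V=+\infty$, $p=0$). Then $\log|x|$ is $\mu$-integrable and, with the geometric mean $m_0=\exp\int_{\mathbb{R}^n}\log|x|\,d\mu(x)$ of the Euclidean norm under $\mu$, $$\operatorname{Var}_\mu(g)\le C_\beta\int_{\mathbb{R}^n}|\nabla g(x)|^2\,\bigl(m_0^2+|x|^2\bigr)\,d\mu(x)$$ for every bounded $C^\infty$ function $g:\mathbb{R}^n\to\mathbb{R}$, where $\operatorname{Var}_\mu(g)=\int g^2\,d\mu-\bigl(\int g\,d\mu\bigr)^2$ and the right-hand side may be $+\infty$. -/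

import Mathlib

open MeasureTheory ProbabilityTheory Set
open scoped NNReal ENNReal ContDiff Gradient

/-- The geometric mean `m₀ = exp ∫ log |x| dμ(x)` of the Euclidean norm under `μ`. -/
noncomputable def geometricMean {n : ℕ} (μ : Measure (EuclideanSpace ℝ (Fin n))) : ℝ :=
  Real.exp (∫ x, Real.log ‖x‖ ∂μ)

/-- `μ` has density `p(x) = V(x)^{-β}` with respect to Lebesgue measure on `ℝⁿ`, where
`V : ℝⁿ → (0, ∞]` is an arbitrary positive convex function, possibly taking the value `∞`
(and `∞^{-β} = 0` for `β > 0`). Convexity is the usual inequality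
`V (a x + b y) ≤ a V x + b V y` for all `x, y ∈ ℝⁿ` and all `a, b ≥ 0` with `a + b = 1`,
in `[0, ∞]`; the weights are taken in `ℝ≥0` since this is what acts on `[0, ∞]`. -/
def HasConvexPowerDensity {n : ℕ} (β : ℝ) (μ : Measure (EuclideanSpace ℝ (Fin n))) : Prop :=
  ∃ V : EuclideanSpace ℝ (Fin n) → ℝ≥0∞,
    (∀ x, 0 < V x) ∧ ConvexOn ℝ≥0 univ V ∧ μ = volume.withDensity (fun x => V x ^ (-β))

/-!
Only finitely many dimensions `n` satisfy `n < β`, so the constant may depend on `n` as well, and it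
suffices to prove the inequality on a fixed space of dimension `d < β`. After changing `V` on the
boundary of its domain, which is a null set, `V` is Borel measurable. Put `p = V ^ (-β)`.

Everything rests on homotheties `x ↦ c + r (x - c)`: convexity bounds `V` after the homothety, and
a linear change of variables compares integrals. Contraction to a point where `V` is small shows
`inf V > 0`, since `β > d`; let `x₀` be a near minimizer and `w = V x₀`. Contraction by `1/2` to `x₀`
shows that a sublevel set `B = {V ≤ K w}` carries a fixed fraction of the mass, so
`w ^ β ≤ C |B|` (`ConvexOn.rpow_le_mul_measure_sublevel`). Averaging the homotheties towards a point
`v` with `V v ≤ K' V` shows that the mean of the negative part of `log (|x| / |v|)` is bounded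
(`ConvexOn.lintegral_log_sub_log_norm_le`). Hence such points satisfy `|v| ≤ C m₀`
(`ConvexOn.norm_le_mul_exp_integral_log_norm`); in particular sublevel sets are bounded, `V` grows
linearly, and `log |x|` is integrable (`ConvexOn.integrable_log_norm`).

For the variance, `Var g ≤ ∫ (g x - g y)² p x dx` for every `y`, and this is averaged over `y ∈ B`.
The increment is bounded by the integral of `|∇g|` over the segment of points
`z = y + s (x - y)`, which is split in two. Where `s ≥ 1/2` or `V z > 2 K w`, convexity gives
`p x ≤ (C s) ^ β p z`, and the substitution of `z` for `x` converges because `β > d`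
(`lintegral_sq_segment_le`). The rest of the segment stays in the bounded set `{V ≤ 2 K w}`, where
`p` is at least a multiple of `w ^ (-β)`, and the substitution of `z` for `y` has bounded Jacobian
since `s < 1/2` (`lintegral_sq_initial_segment_le`).
-/

/-! ### Convex functions with values in `[0, ∞]`, homotheties and near minimizers -/

section ConvexPowerDensity

open Module Filter Topology

variable {E : Type*} [NormedAddCommGroup E] [NormedSpace ℝ E]

theorem ConvexOn.le_add_smul_sub {V : E → ℝ≥0∞} (hV : ConvexOn ℝ≥0 univ V) (x y : E) {t : ℝ}
    (h0 : 0 ≤ t) (h1 : t ≤ 1) :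
    V (x + t • (y - x)) ≤ ENNReal.ofReal (1 - t) * V x + ENNReal.ofReal t * V y := by
  have h := hV.2 (mem_univ x) (mem_univ y) (zero_le (a := Real.toNNReal (1 - t)))
    (zero_le (a := Real.toNNReal t)) (by
      rw [← Real.toNNReal_add (by linarith) h0]; simp)
  have e : x + t • (y - x) = Real.toNNReal (1 - t) • x + Real.toNNReal t • y := by
    rw [NNReal.smul_def, NNReal.smul_def, Real.coe_toNNReal _ (by linarith),
      Real.coe_toNNReal _ h0]
    module
  rw [e]
  exact h

theorem ENNReal.rpow_neg_le_mul_rpow_neg {a b A : ℝ≥0∞} {β : ℝ} (hβ : 0 ≤ β) (ha : a ≠ 0)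
    (hA : A ≠ 0) (hA' : A ≠ ⊤) (h : b ≤ A * a) : a ^ (-β) ≤ A ^ β * b ^ (-β) := by
  have h1 : (A * a) ^ (-β) ≤ b ^ (-β) := by
    rw [ENNReal.rpow_neg, ENNReal.rpow_neg]
    exact ENNReal.inv_le_inv.2 (ENNReal.rpow_le_rpow h hβ)
  calc a ^ (-β) = A ^ β * (A * a) ^ (-β) := by
        rw [ENNReal.mul_rpow_of_ne_zero hA ha, ← mul_assoc, ← ENNReal.rpow_add _ _ hA hA']
        simp
    _ ≤ _ := by gcongr

variable [FiniteDimensional ℝ E] [MeasurableSpace E] [BorelSpace E]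
  (ν : Measure E) [ν.IsAddHaarMeasure]

theorem lintegral_comp_homothety (f : E → ℝ≥0∞) (c : E) {r : ℝ} (hr : 0 < r) :
    ∫⁻ x, f (c + r • (x - c)) ∂ν = ENNReal.ofReal ((r ^ finrank ℝ E)⁻¹) * ∫⁻ x, f x ∂ν := by
  have h1 : ∫⁻ x, f (c + r • (x - c)) ∂ν = ∫⁻ x, f (c + r • x) ∂ν :=
    lintegral_sub_right_eq_self (fun x => f (c + r • x)) c
  have h2 : ∫⁻ x, f (c + r • x) ∂ν = ∫⁻ x, f (c + x) ∂(Measure.map (r • ·) ν) :=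
    ((Homeomorph.smulOfNeZero r hr.ne').measurableEmbedding.lintegral_map
      (fun x => f (c + x))).symm
  rw [h1, h2, Measure.map_addHaar_smul ν hr.ne', lintegral_smul_measure,
    lintegral_add_left_eq_self f c, abs_of_pos (by positivity), smul_eq_mul]

/-- A convex function with values in `[0, ∞]` is a.e. equal to a Borel convex function, which is
obtained by raising it to `∞` outside the interior of its domain. -/
theorem ConvexOn.exists_measurable_ae_eq {V : E → ℝ≥0∞} (hV : ConvexOn ℝ≥0 univ V) :
    ∃ W : E → ℝ≥0∞, Measurable W ∧ ConvexOn ℝ≥0 univ W ∧ V ≤ W ∧ W =ᵐ[ν] V := by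
  classical
  set D : Set E := {x | V x ≠ ⊤} with hD
  have hlt : ∀ x ∈ D, ∀ y ∈ D, ∀ a b : ℝ≥0, a • V x + b • V y ≠ ⊤ := by
    intro x hx y hy a b
    simp only [ENNReal.smul_def, smul_eq_mul]
    exact ENNReal.add_ne_top.2
      ⟨ENNReal.mul_ne_top (by simp) hx, ENNReal.mul_ne_top (by simp) hy⟩
  have key : ∀ x y : E, ∀ a b : ℝ≥0, (a : ℝ) + b = 1 →
      V ((a : ℝ) • x + (b : ℝ) • y) ≤ a • V x + b • V y := fun x y a b hab =>
    hV.2 (mem_univ x) (mem_univ y) (zero_le (a := a)) (zero_le (a := b)) (NNReal.eq hab)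
  have hDc : Convex ℝ D := by
    intro x hx y hy a b ha hb hab
    exact ne_top_of_le_ne_top (hlt x hx y hy _ _) (key x y ⟨a, ha⟩ ⟨b, hb⟩ hab)
  have hU : Convex ℝ (interior D) := hDc.interior
  have hreal : ConvexOn ℝ (interior D) (fun x => (V x).toReal) := by
    refine ⟨hU, ?_⟩
    intro x hx y hy a b ha hb hab
    lift a to ℝ≥0 using ha
    lift b to ℝ≥0 using hb
    have hx : V x ≠ ⊤ := interior_subset hx
    have hy : V y ≠ ⊤ := interior_subset hy
    have h := ENNReal.toReal_mono (hlt x hx y hy a b) (key x y a b hab)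
    simp only [ENNReal.smul_def, smul_eq_mul] at h
    rw [ENNReal.toReal_add (ENNReal.mul_ne_top (by simp) hx) (ENNReal.mul_ne_top (by simp) hy)] at h
    simpa using h
  have hcont := hreal.continuousOn isOpen_interior
  refine ⟨fun x => if x ∈ interior D then V x else ⊤, ?_, ⟨convex_univ, ?_⟩, ?_, ?_⟩
  · have h1 : Measurable (fun x => if x ∈ interior D then (V x).toReal else 0) :=
      hcont.measurable_piecewise (g := fun _ => (0 : ℝ)) continuousOn_const
        isOpen_interior.measurableSet
    have h2 : (fun x => if x ∈ interior D then V x else ⊤) = fun x =>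
        if x ∈ interior D then
          ENNReal.ofReal (if x ∈ interior D then (V x).toReal else 0) else ⊤ := by
      funext x
      by_cases hx : x ∈ interior D
      · simp only [hx, if_true]
        rw [ENNReal.ofReal_toReal (interior_subset hx)]
      · simp [hx]
    rw [h2]
    exact Measurable.ite isOpen_interior.measurableSet h1.ennreal_ofReal measurable_const
  · intro x _ y _ a b ha hb hab
    rcases eq_or_ne a 0 with rfl | ha0
    · have : b = 1 := by simpa using hab
      subst this; simp
    rcases eq_or_ne b 0 with rfl | hb0
    · have : a = 1 := by simpa using hab
      subst this; simp
    by_cases hx : x ∈ interior D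
    · by_cases hy : y ∈ interior D
      · have hz : a • x + b • y ∈ interior D := by
          have := hU hx hy a.2 b.2 (congrArg NNReal.toReal hab)
          exact this
        simp only [hx, hy, hz, if_true]
        exact hV.2 (mem_univ x) (mem_univ y) ha hb hab
      · simp [hy, ENNReal.smul_def, ENNReal.mul_top, hb0]
    · simp [hx, ENNReal.smul_def, ENNReal.mul_top, ha0]
  · intro x
    by_cases hx : x ∈ interior D
    · simp [hx]
    · simp [hx]
  · have h0 : ν (frontier D) = 0 := hDc.addHaar_frontier ν
    filter_upwards [measure_eq_zero_iff_ae_notMem.1 h0] with x hx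
    by_cases hxi : x ∈ interior D
    · simp [hxi]
    · have hxD : x ∉ D := fun h => hx ⟨subset_closure h, hxi⟩
      have : V x = ⊤ := by simpa [hD] using hxD
      simp [hxi, this]

variable {ν}

/-- A convex function with `∫ V ^ (-β) = 1` and `β > d` is bounded away from zero: otherwise contraction
to a point where `V` is small would produce too much mass. -/
theorem ConvexOn.iInf_ne_zero_of_lintegral_rpow_neg {V : E → ℝ≥0∞} {β : ℝ}
    (hβ : (finrank ℝ E : ℝ) < β) (hV : ConvexOn ℝ≥0 univ V)
    (hm : Measurable V) (h1 : ∫⁻ x, V x ^ (-β) ∂ν = 1) : ⨅ x, V x ≠ 0 := by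
  intro h0
  have hβ0 : 0 < β := lt_of_le_of_lt (Nat.cast_nonneg _) hβ
  set c := ∫⁻ x, (1 + V x) ^ (-β) ∂ν with hc
  have hc0 : c ≠ 0 := by
    intro h
    rw [hc, lintegral_eq_zero_iff (by fun_prop)] at h
    have : ∫⁻ x, V x ^ (-β) ∂ν = 0 := by
      rw [lintegral_eq_zero_iff (by fun_prop)]
      filter_upwards [h] with x hx
      have : V x = ⊤ := by
        simp only [Pi.zero_apply, ENNReal.rpow_eq_zero_iff] at hx
        rcases hx with hx | hx
        · linarith [hx.2]
        · simpa using hx.1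
      simp [this, hβ0]
    simp [this] at h1
  -- Contraction by `η` towards a point where `V < η` shows `c ≤ η ^ (β - d)`.
  have hη : ∀ η : ℝ, 0 < η → η ≤ 1 → c ≤ ENNReal.ofReal (η ^ (β - finrank ℝ E)) := by
    intro η hη hη1
    obtain ⟨v, hv⟩ : ∃ v, V v < ENNReal.ofReal η := by
      rw [← iInf_lt_iff, h0]; simpa using hη
    have hηn : ENNReal.ofReal η ≠ 0 := by simpa using hη
    have hp : ∀ x, (1 + V x) ^ (-β) ≤
        ENNReal.ofReal η ^ β * V (v + η • (x - v)) ^ (-β) := by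
      intro x
      refine ENNReal.rpow_neg_le_mul_rpow_neg hβ0.le (by simp) hηn (by simp) ?_
      refine (hV.le_add_smul_sub v x hη.le hη1).trans ?_
      rw [mul_add, mul_one]
      gcongr
      calc ENNReal.ofReal (1 - η) * V v ≤ 1 * V v := by
            gcongr; exact ENNReal.ofReal_le_one.2 (by linarith)
        _ ≤ _ := by rw [one_mul]; exact hv.le
    calc c ≤ ∫⁻ x, ENNReal.ofReal η ^ β * V (v + η • (x - v)) ^ (-β) ∂ν := lintegral_mono hp
      _ = ENNReal.ofReal η ^ β * ENNReal.ofReal ((η ^ finrank ℝ E)⁻¹) := by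
        rw [lintegral_const_mul _ (by fun_prop),
          lintegral_comp_homothety ν (fun x => V x ^ (-β)) v hη, h1, mul_one]
      _ = _ := by
        rw [ENNReal.ofReal_rpow_of_pos hη, ← ENNReal.ofReal_mul (by positivity),
          Real.rpow_sub hη, Real.rpow_natCast, div_eq_mul_inv]
  have hlim : Tendsto (fun η : ℝ => ENNReal.ofReal (η ^ (β - finrank ℝ E))) (𝓝[>] 0) (𝓝 0) := by
    have : Tendsto (fun η : ℝ => η ^ (β - finrank ℝ E)) (𝓝[>] 0) (𝓝 0) := by
      have := (Real.continuousAt_rpow_const 0 (β - finrank ℝ E) (Or.inr (by linarith))).tendsto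
      rw [Real.zero_rpow (by linarith)] at this
      exact this.mono_left nhdsWithin_le_nhds
    simpa using ENNReal.tendsto_ofReal this
  refine hc0 (le_antisymm (ge_of_tendsto hlim ?_) zero_le)
  filter_upwards [Ioo_mem_nhdsGT (zero_lt_one (α := ℝ))] with η h
  exact hη η h.1 h.2.le

/-- A convex function `V` with `∫ V ^ (-β) = 1` has near minimizers, and is finite there. -/
theorem ConvexOn.exists_near_minimizer {V : E → ℝ≥0∞} {β : ℝ}
    (hβ : (finrank ℝ E : ℝ) < β) (hV : ConvexOn ℝ≥0 univ V)
    (hm : Measurable V) (h1 : ∫⁻ x, V x ^ (-β) ∂ν = 1) :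
    ∃ x₀, V x₀ ≠ ⊤ ∧ ∀ x, V x₀ ≤ 2 * V x := by
  have hβ0 : 0 < β := lt_of_le_of_lt (Nat.cast_nonneg _) hβ
  have h0 := hV.iInf_ne_zero_of_lintegral_rpow_neg hβ hm h1
  have htop : ⨅ x, V x ≠ ⊤ := by
    intro h
    rw [iInf_eq_top] at h
    simp [h, hβ0] at h1
  obtain ⟨x₀, hx⟩ : ∃ x, V x < 2 * ⨅ x, V x := by
    rw [← iInf_lt_iff, two_mul]
    exact ENNReal.lt_add_right htop h0
  refine ⟨x₀, hx.ne_top, fun x => hx.le.trans ?_⟩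
  gcongr
  exact iInf_le _ _

/-- The domain of `V` is not contained in `{0}`, which is a null set. -/
theorem exists_ne_zero_ne_top [Nontrivial E] {V : E → ℝ≥0∞} {β : ℝ} (hβ : 0 < β)
    (h1 : ∫⁻ x, V x ^ (-β) ∂ν = 1) : ∃ v, v ≠ 0 ∧ V v ≠ ⊤ := by
  by_contra! h
  have : ∫⁻ x, V x ^ (-β) ∂ν = ∫⁻ _, 0 ∂ν := by
    apply lintegral_congr_ae
    filter_upwards [measure_eq_zero_iff_ae_notMem.1 (measure_singleton (μ := ν) (0 : E))] with x hx
    simp [h x hx, hβ]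
  simp [this] at h1

end ConvexPowerDensity

/-! ### The logarithm of the norm -/

section ConvexPowerDensity

open Module Filter Topology

theorem lintegral_ofReal_neg_log_ne_top : ∫⁻ t : ℝ, ENNReal.ofReal (-Real.log t) ≠ ⊤ := by
  have h1 : ∫⁻ t : ℝ, ENNReal.ofReal (-Real.log t) =
      ∫⁻ t in Icc (-1 : ℝ) 1, ENNReal.ofReal (-Real.log t) := by
    rw [← lintegral_indicator measurableSet_Icc]
    refine lintegral_congr fun t => ?_
    by_cases ht : t ∈ Icc (-1 : ℝ) 1
    · simp [ht]
    · rw [indicator_of_notMem ht, ENNReal.ofReal_eq_zero, neg_nonpos, ← Real.log_abs]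
      refine Real.log_nonneg ?_
      by_contra! h
      exact ht ⟨(abs_lt.1 h).1.le, (abs_lt.1 h).2.le⟩
  have h2 : IntegrableOn (fun t : ℝ => -Real.log t) (Icc (-1) 1) := by
    have := (intervalIntegral.intervalIntegrable_log' (a := -1) (b := 1)).neg
    rwa [intervalIntegrable_iff_integrableOn_Icc_of_le (by norm_num)] at this
  rw [h1]
  exact h2.lintegral_lt_top.ne

variable {E : Type*} [NormedAddCommGroup E] [NormedSpace ℝ E]
  [FiniteDimensional ℝ E] [MeasurableSpace E] [BorelSpace E]
  {ν : Measure E} [ν.IsAddHaarMeasure]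

/-- The constant `2 ^ (d + 1) K ^ β ∫ log⁻ |t| dt` in the bound for the negative part of the
logarithm of the norm under a density `V ^ (-β)` on a space of dimension `d`. -/
noncomputable def negLogConst (d : ℕ) (β : ℝ) (K : ℝ≥0∞) : ℝ≥0∞ :=
  2 * (2 ^ d * K ^ β * ∫⁻ t : ℝ, ENNReal.ofReal (-Real.log t))

theorem negLogConst_ne_top (d : ℕ) {β : ℝ} (hβ : 0 ≤ β) {K : ℝ≥0∞} (hK : K ≠ ⊤) :
    negLogConst d β K ≠ ⊤ :=
  ENNReal.mul_ne_top (by simp) (ENNReal.mul_ne_top (ENNReal.mul_ne_top (by simp)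
    (ENNReal.rpow_ne_top_of_nonneg hβ hK)) lintegral_ofReal_neg_log_ne_top)

/-- If `v` is a point with `V v ≤ K V` everywhere, the density `p = V ^ (-β)` satisfies
`p x ≤ K ^ β p (v + r (x - v))` for all `r ∈ [1/2, 1]`. Thus the mass near the origin is
spread along the segments towards `v`, and averaging over `r` bounds the negative part of
`log (|x| / |v|)` in mean. -/
theorem ConvexOn.lintegral_log_sub_log_norm_le {V : E → ℝ≥0∞} {β : ℝ} (hβ : 0 ≤ β)
    (hpos : ∀ x, 0 < V x) (hV : ConvexOn ℝ≥0 univ V)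
    (hm : Measurable V) (h1 : ∫⁻ x, V x ^ (-β) ∂ν = 1) {K : ℝ≥0∞} (hK1 : 1 ≤ K) (hK : K ≠ ⊤)
    {v : E} (hv0 : v ≠ 0) (hv : ∀ x, V v ≤ K * V x) :
    ∫⁻ x, ENNReal.ofReal (Real.log ‖v‖ - Real.log ‖x‖) * V x ^ (-β) ∂ν ≤
      negLogConst (finrank ℝ E) β K := by
  set d := finrank ℝ E
  set f : E → ℝ≥0∞ := fun x => ENNReal.ofReal (Real.log ‖v‖ - Real.log ‖x‖) with hf
  have hfm : Measurable f := by fun_prop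
  set I := ∫⁻ x, f x * V x ^ (-β) ∂ν with hI
  have hKβ : K ^ β ≠ ⊤ := ENNReal.rpow_ne_top_of_nonneg hβ hK
  have hvn : 0 < ‖v‖ := norm_pos_iff.2 hv0
  have step : ∀ r ∈ Icc (1 / 2 : ℝ) 1,
      I ≤ 2 ^ d * K ^ β * ∫⁻ y, f (v + r⁻¹ • (y - v)) * V y ^ (-β) ∂ν := by
    intro r hr
    have hr0 : 0 < r := by linarith [hr.1]
    have hp : ∀ x, V x ^ (-β) ≤ K ^ β * V (v + r • (x - v)) ^ (-β) := by
      intro x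
      refine ENNReal.rpow_neg_le_mul_rpow_neg hβ (hpos x).ne' (by positivity) hK ?_
      calc V (v + r • (x - v)) ≤ ENNReal.ofReal (1 - r) * V v + ENNReal.ofReal r * V x :=
            hV.le_add_smul_sub v x hr0.le hr.2
        _ ≤ ENNReal.ofReal (1 - r) * (K * V x) + ENNReal.ofReal r * (K * V x) := by
            gcongr
            · exact hv x
            · calc V x = 1 * V x := (one_mul _).symm
                _ ≤ _ := by gcongr
        _ = K * V x := by
            rw [← add_mul, ← ENNReal.ofReal_add (by linarith [hr.2]) hr0.le]
            simp
    calc I ≤ ∫⁻ x, K ^ β * (f x * V (v + r • (x - v)) ^ (-β)) ∂ν := by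
          refine lintegral_mono fun x => ?_
          calc f x * V x ^ (-β) ≤ f x * (K ^ β * V (v + r • (x - v)) ^ (-β)) := by
                gcongr; exact hp x
            _ = _ := by ring
      _ = K ^ β * ∫⁻ x, f x * V (v + r • (x - v)) ^ (-β) ∂ν := lintegral_const_mul' _ _ hKβ
      _ = K ^ β * (ENNReal.ofReal ((r ^ d)⁻¹) *
            ∫⁻ y, f (v + r⁻¹ • (y - v)) * V y ^ (-β) ∂ν) := by
          rw [← lintegral_comp_homothety ν _ v hr0]
          congr 2
          funext x
          congr 2
          rw [add_sub_cancel_left, smul_smul, inv_mul_cancel₀ hr0.ne', one_smul]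
          abel
      _ ≤ K ^ β * (2 ^ d * ∫⁻ y, f (v + r⁻¹ • (y - v)) * V y ^ (-β) ∂ν) := by
          gcongr
          rw [← inv_pow]
          calc ENNReal.ofReal (r⁻¹ ^ d) ≤ ENNReal.ofReal (2 ^ d) := by
                gcongr
                rw [inv_le_comm₀ hr0 (by norm_num)]
                linarith [hr.1]
            _ = 2 ^ d := by rw [ENNReal.ofReal_pow (by norm_num)]; simp
      _ = _ := by ring
  have inner : ∀ y, ∫⁻ r in Icc (1 / 2 : ℝ) 1, f (v + r⁻¹ • (y - v)) ≤
      ∫⁻ t : ℝ, ENNReal.ofReal (-Real.log t) := by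
    intro y
    calc ∫⁻ r in Icc (1 / 2 : ℝ) 1, f (v + r⁻¹ • (y - v))
        ≤ ∫⁻ r in Icc (1 / 2 : ℝ) 1, ENNReal.ofReal (-Real.log (r + (‖y‖ / ‖v‖ - 1))) := by
          refine lintegral_mono_ae ?_
          -- At the excluded value of `r`, the convention `log 0 = 0` breaks the inequality.
          have hne : ∀ᵐ r : ℝ, r ≠ 1 - ‖y‖ / ‖v‖ := by simp [ae_iff]
          filter_upwards [ae_restrict_mem measurableSet_Icc, ae_restrict_of_ae hne] with r hr hrne
          have hr0 : 0 < r := by linarith [hr.1]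
          set u := r + (‖y‖ / ‖v‖ - 1) with hu
          have hu0 : u ≠ 0 := fun h => hrne (by linarith)
          refine ENNReal.ofReal_le_ofReal ?_
          have hlow : ‖v‖ * |u| ≤ ‖v + r⁻¹ • (y - v)‖ := by
            have e : ‖v‖ * |u| = |‖y‖ - ‖(1 - r) • v‖| := by
              rw [norm_smul, Real.norm_of_nonneg (by linarith [hr.2]), hu]
              nth_rewrite 1 [← abs_of_pos hvn]
              rw [← abs_mul]
              congr 1
              field_simp
              ring
            have e2 : y - (1 - r) • v = r • (v + r⁻¹ • (y - v)) := by
              rw [smul_add, smul_smul, mul_inv_cancel₀ hr0.ne']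
              module
            rw [e]
            refine (abs_norm_sub_norm_le _ _).trans ?_
            rw [e2, norm_smul, Real.norm_of_nonneg hr0.le]
            exact mul_le_of_le_one_left (norm_nonneg _) hr.2
          have := Real.log_le_log (by positivity) hlow
          rw [Real.log_mul hvn.ne' (by positivity), Real.log_abs] at this
          linarith
      _ ≤ ∫⁻ r : ℝ, ENNReal.ofReal (-Real.log (r + (‖y‖ / ‖v‖ - 1))) := setLIntegral_le_lintegral _ _
      _ = _ := lintegral_add_right_eq_self (fun t : ℝ => ENNReal.ofReal (-Real.log t)) _
  have avg : I * ENNReal.ofReal (1 / 2) ≤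
      2 ^ d * K ^ β * ∫⁻ t : ℝ, ENNReal.ofReal (-Real.log t) := by
    calc I * ENNReal.ofReal (1 / 2) = ∫⁻ _ in Icc (1 / 2 : ℝ) 1, I := by
          rw [setLIntegral_const, Real.volume_Icc]; norm_num
      _ ≤ ∫⁻ r in Icc (1 / 2 : ℝ) 1,
            2 ^ d * K ^ β * ∫⁻ y, f (v + r⁻¹ • (y - v)) * V y ^ (-β) ∂ν :=
          setLIntegral_mono' measurableSet_Icc step
      _ = 2 ^ d * K ^ β * ∫⁻ r in Icc (1 / 2 : ℝ) 1,
            ∫⁻ y, f (v + r⁻¹ • (y - v)) * V y ^ (-β) ∂ν :=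
          lintegral_const_mul' _ _ (ENNReal.mul_ne_top (by simp) hKβ)
      _ = 2 ^ d * K ^ β * ∫⁻ y, (∫⁻ r in Icc (1 / 2 : ℝ) 1,
            f (v + r⁻¹ • (y - v)) * V y ^ (-β)) ∂ν := by
          rw [lintegral_lintegral_swap]
          exact Measurable.aemeasurable (by fun_prop)
      _ ≤ 2 ^ d * K ^ β * ∫⁻ y, (∫⁻ t : ℝ, ENNReal.ofReal (-Real.log t)) * V y ^ (-β) ∂ν := by
          gcongr with y
          rw [lintegral_mul_const _ (by fun_prop)]
          exact mul_le_mul' (inner y) le_rfl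
      _ = _ := by
          rw [lintegral_const_mul _ (by fun_prop), h1, mul_one]
  calc I = 2 * (I * ENNReal.ofReal (1 / 2)) := by
        rw [mul_comm I, ← mul_assoc, show (2 : ℝ≥0∞) = ENNReal.ofReal 2 by simp,
          ← ENNReal.ofReal_mul (by norm_num)]
        norm_num
    _ ≤ _ := by
        unfold negLogConst
        gcongr

theorem isProbabilityMeasure_withDensity_of_lintegral_eq_one {α : Type*} [MeasurableSpace α]
    {ν : Measure α} {p : α → ℝ≥0∞} (h1 : ∫⁻ x, p x ∂ν = 1) : IsProbabilityMeasure (ν.withDensity p) :=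
  ⟨by rw [withDensity_apply _ MeasurableSet.univ, setLIntegral_univ, h1]⟩

/-- Sublevel sets of `V` of comparable level are bounded: some ball has positive mass, and the mean
of `log (|v| / |x|)` over it is bounded uniformly in `v`. -/
theorem ConvexOn.exists_norm_le_of_le_mul {V : E → ℝ≥0∞} {β : ℝ} (hβ : 0 ≤ β)
    (hpos : ∀ x, 0 < V x) (hV : ConvexOn ℝ≥0 univ V)
    (hm : Measurable V) (h1 : ∫⁻ x, V x ^ (-β) ∂ν = 1) {K : ℝ≥0∞} (hK1 : 1 ≤ K) (hK : K ≠ ⊤) :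
    ∃ ρ : ℝ, 0 ≤ ρ ∧ ∀ v, (∀ x, V v ≤ K * V x) → ‖v‖ ≤ ρ := by
  have := isProbabilityMeasure_withDensity_of_lintegral_eq_one h1
  set μ := ν.withDensity fun x => V x ^ (-β) with hμ
  obtain ⟨N, hN⟩ : ∃ N : ℕ, μ (Metric.closedBall 0 N) ≠ 0 := by
    by_contra! h
    have := measure_iUnion_null h
    rw [Metric.iUnion_closedBall_nat] at this
    simp at this
  set m := μ (Metric.closedBall 0 (N : ℝ)) with hmdef
  set R : ℝ := N + 1
  have hR : 1 ≤ R := by simp [R]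
  set C := negLogConst (finrank ℝ E) β K
  have hC : C ≠ ⊤ := negLogConst_ne_top _ hβ hK
  refine ⟨R * Real.exp (C / m).toReal, by positivity, fun v hv => ?_⟩
  rcases eq_or_ne v 0 with rfl | hv0
  · rw [norm_zero]; positivity
  have hvn : 0 < ‖v‖ := norm_pos_iff.2 hv0
  have h := hV.lintegral_log_sub_log_norm_le hβ hpos hm h1 hK1 hK hv0 hv
  have h2 : ENNReal.ofReal (Real.log ‖v‖ - Real.log R) * m ≤ C := by
    refine le_trans ?_ h
    calc ENNReal.ofReal (Real.log ‖v‖ - Real.log R) * m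
        = ∫⁻ _ in Metric.closedBall 0 (N : ℝ),
            ENNReal.ofReal (Real.log ‖v‖ - Real.log R) ∂μ := by
          rw [setLIntegral_const]
      _ ≤ ∫⁻ x in Metric.closedBall 0 (N : ℝ),
            ENNReal.ofReal (Real.log ‖v‖ - Real.log ‖x‖) ∂μ := by
          refine setLIntegral_mono' Metric.isClosed_closedBall.measurableSet fun x hx => ?_
          refine ENNReal.ofReal_le_ofReal (sub_le_sub_left ?_ _)
          rcases eq_or_ne x 0 with rfl | hx0
          · simpa using Real.log_nonneg hR
          · refine Real.log_le_log (norm_pos_iff.2 hx0) ?_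
            have := mem_closedBall_zero_iff.1 hx
            simp only [R]
            linarith
      _ ≤ ∫⁻ x, ENNReal.ofReal (Real.log ‖v‖ - Real.log ‖x‖) ∂μ := setLIntegral_le_lintegral _ _
      _ = _ := by
          rw [hμ, lintegral_withDensity_eq_lintegral_mul _ (by fun_prop) (by fun_prop)]
          simp only [Pi.mul_apply, mul_comm]
  have h3 : Real.log ‖v‖ - Real.log R ≤ (C / m).toReal := by
    refine (ENNReal.ofReal_le_iff_le_toReal (ENNReal.div_ne_top hC hN)).1 ?_
    rwa [ENNReal.le_div_iff_mul_le (Or.inl hN) (Or.inl (measure_ne_top _ _))]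
  rw [← Real.exp_log hvn]
  calc Real.exp (Real.log ‖v‖) ≤ Real.exp (Real.log R + (C / m).toReal) :=
        Real.exp_le_exp.2 (by linarith)
    _ = _ := by rw [Real.exp_add, Real.exp_log (by linarith)]

/-- A convex function `V` with `∫ V ^ (-β) = 1` grows at least linearly. -/
theorem ConvexOn.exists_linear_growth {V : E → ℝ≥0∞} {β : ℝ} (hβ : (finrank ℝ E : ℝ) < β)
    (hpos : ∀ x, 0 < V x) (hV : ConvexOn ℝ≥0 univ V)
    (hm : Measurable V) (h1 : ∫⁻ x, V x ^ (-β) ∂ν = 1) :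
    ∃ c : ℝ, 0 < c ∧ ∀ x, ENNReal.ofReal (c * (1 + ‖x‖)) ≤ V x := by
  have hβ0 : 0 ≤ β := (Nat.cast_nonneg _).trans hβ.le
  obtain ⟨x₀, hx₀, hmin⟩ := hV.exists_near_minimizer hβ hm h1
  obtain ⟨ρ, hρ0, hρ⟩ := hV.exists_norm_le_of_le_mul hβ0 hpos hm h1 (K := 4)
    (by norm_num) (by norm_num)
  set w := (V x₀).toReal with hw
  have hVw : V x₀ = ENNReal.ofReal w := (ENNReal.ofReal_toReal hx₀).symm
  have hw0 : 0 < w := ENNReal.toReal_pos (hpos x₀).ne' hx₀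
  have hmin' : ∀ x, ENNReal.ofReal (w / 2) ≤ V x := by
    intro x
    rw [ENNReal.ofReal_div_of_pos (by norm_num), ← hVw]
    refine ENNReal.div_le_of_le_mul ?_
    rw [mul_comm]; simpa using hmin x
  set R := ρ + ‖x₀‖ + 1 with hR
  have hx0n := norm_nonneg x₀
  have hR0 : 0 < R := by positivity
  set c := w / (2 * (1 + ‖x₀‖ + R)) with hc
  have hc0 : 0 < c := by positivity
  have hcw : c * (1 + ‖x₀‖ + R) = w / 2 := by rw [hc]; field_simp
  refine ⟨c, hc0, fun x => ?_⟩
  have htri : ‖x‖ ≤ ‖x₀‖ + ‖x - x₀‖ := by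
    calc ‖x‖ = ‖x₀ + (x - x₀)‖ := by rw [add_sub_cancel]
      _ ≤ _ := norm_add_le _ _
  rcases le_or_gt ‖x - x₀‖ R with hle | hgt
  · refine le_trans (ENNReal.ofReal_le_ofReal ?_) (hmin' x)
    rw [← hcw]
    exact mul_le_mul_of_nonneg_left (by linarith) hc0.le
  · set s := R / ‖x - x₀‖ with hs
    have hD : 0 < ‖x - x₀‖ := hR0.trans hgt
    have hs0 : 0 < s := by positivity
    have hs1 : s ≤ 1 := by rw [hs, div_le_one hD]; exact hgt.le
    have hz : ρ < ‖x₀ + s • (x - x₀)‖ := by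
      have e : ‖s • (x - x₀)‖ = R := by
        rw [norm_smul, Real.norm_of_nonneg hs0.le, hs]; field_simp
      have := norm_sub_norm_le (s • (x - x₀)) (-x₀)
      rw [norm_neg, sub_neg_eq_add, add_comm _ x₀, e] at this
      linarith
    have hVz : ENNReal.ofReal (2 * w) < V (x₀ + s • (x - x₀)) := by
      by_contra! h
      refine hz.not_ge (hρ _ fun y => ?_)
      calc V (x₀ + s • (x - x₀)) ≤ ENNReal.ofReal (2 * w) := h
        _ = 4 * ENNReal.ofReal (w / 2) := by
          rw [show (4 : ℝ≥0∞) = ENNReal.ofReal 4 by simp, ← ENNReal.ofReal_mul (by norm_num)]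
          congr 1; ring
        _ ≤ _ := by gcongr; exact hmin' y
    by_contra! hlt
    have h := hV.le_add_smul_sub x₀ x hs0.le hs1
    refine hVz.not_ge (h.trans ?_)
    calc ENNReal.ofReal (1 - s) * V x₀ + ENNReal.ofReal s * V x
        ≤ 1 * V x₀ + ENNReal.ofReal s * ENNReal.ofReal (c * (1 + ‖x‖)) := by
          gcongr
          exact ENNReal.ofReal_le_one.2 (by linarith)
      _ = ENNReal.ofReal (w + s * (c * (1 + ‖x‖))) := by
          rw [one_mul, hVw, ← ENNReal.ofReal_mul hs0.le, ← ENNReal.ofReal_add hw0.le (by positivity)]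
      _ ≤ _ := by
          refine ENNReal.ofReal_le_ofReal ?_
          have h3 : s * (1 + ‖x‖) ≤ 1 + ‖x₀‖ + R := by
            calc s * (1 + ‖x‖) ≤ s * (1 + ‖x₀‖ + ‖x - x₀‖) :=
                mul_le_mul_of_nonneg_left (by linarith) hs0.le
              _ = s * (1 + ‖x₀‖) + R := by rw [mul_add, hs]; field_simp
              _ ≤ 1 * (1 + ‖x₀‖) + R := by gcongr
              _ = _ := by ring
          have h4 : c * (s * (1 + ‖x‖)) ≤ w / 2 := by rw [← hcw]; gcongr
          linarith [mul_left_comm s c (1 + ‖x‖)]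

theorem ConvexOn.integrable_log_norm [Nontrivial E] {V : E → ℝ≥0∞} {β : ℝ}
    (hβ : (finrank ℝ E : ℝ) < β) (hpos : ∀ x, 0 < V x) (hV : ConvexOn ℝ≥0 univ V)
    (hm : Measurable V) (h1 : ∫⁻ x, V x ^ (-β) ∂ν = 1) :
    Integrable (fun x => Real.log ‖x‖) (ν.withDensity fun x => V x ^ (-β)) := by
  have hβ0 : 0 < β := lt_of_le_of_lt (Nat.cast_nonneg _) hβ
  have := isProbabilityMeasure_withDensity_of_lintegral_eq_one h1
  set μ := ν.withDensity fun x => V x ^ (-β) with hμ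
  have hlin : ∀ f : E → ℝ≥0∞, Measurable f → ∫⁻ x, f x ∂μ = ∫⁻ x, f x * V x ^ (-β) ∂ν := by
    intro f hf
    rw [hμ, lintegral_withDensity_eq_lintegral_mul _ (by fun_prop) hf]
    simp only [Pi.mul_apply, mul_comm]
  -- The negative part, by comparison with a point `v ≠ 0` in the domain of `V`.
  have hneg : ∃ v : E, ∫⁻ x, ENNReal.ofReal (Real.log ‖v‖ - Real.log ‖x‖) ∂μ ≠ ⊤ := by
    obtain ⟨v, hv0, hv⟩ := exists_ne_zero_ne_top hβ0 h1
    have hi := hV.iInf_ne_zero_of_lintegral_rpow_neg hβ hm h1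
    refine ⟨v, ?_⟩
    have hK : max 1 (V v / ⨅ x, V x) ≠ ⊤ := by simp [ENNReal.div_eq_top, hv, hi]
    rw [hlin _ (by fun_prop)]
    refine ne_top_of_le_ne_top (negLogConst_ne_top _ hβ0.le hK)
      (hV.lintegral_log_sub_log_norm_le hβ0.le hpos hm h1 (le_max_left _ _) hK hv0 fun x => ?_)
    have hfin : ⨅ x, V x ≠ ⊤ := ne_top_of_le_ne_top hv (iInf_le _ v)
    calc V v = V v / (⨅ x, V x) * ⨅ x, V x := (ENNReal.div_mul_cancel hi hfin).symm
      _ ≤ _ := by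
        gcongr
        · exact le_max_right _ _
        · exact iInf_le _ x
  -- The positive part, from the linear growth of `V`.
  have hposi : ∫⁻ x, ENNReal.ofReal (Real.log (1 + ‖x‖)) ∂μ ≠ ⊤ := by
    obtain ⟨c, hc, hcV⟩ := hV.exists_linear_growth hβ hpos hm h1
    set ε := (β - finrank ℝ E) / 2 with hε
    have hε0 : 0 < ε := by rw [hε]; linarith
    have hfin := finite_integral_one_add_norm (E := E) (μ := ν) (r := β - ε)
      (by rw [hε]; linarith)
    rw [hlin _ (by fun_prop)]
    have hb : ∫⁻ x, ENNReal.ofReal (c ^ (-β) / ε) * ENNReal.ofReal ((1 + ‖x‖) ^ (-(β - ε))) ∂ν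
        ≠ ⊤ := by
      rw [lintegral_const_mul _ (by fun_prop)]
      exact ENNReal.mul_ne_top (by simp) hfin.ne
    refine ne_top_of_le_ne_top hb (lintegral_mono fun x => ?_)
    have hx : 0 < 1 + ‖x‖ := by positivity
    calc ENNReal.ofReal (Real.log (1 + ‖x‖)) * V x ^ (-β)
        ≤ ENNReal.ofReal ((1 + ‖x‖) ^ ε / ε) * ENNReal.ofReal ((c * (1 + ‖x‖)) ^ (-β)) := by
          gcongr
          · exact Real.log_le_rpow_div hx.le hε0
          · rw [← ENNReal.ofReal_rpow_of_pos (by positivity), ENNReal.rpow_neg, ENNReal.rpow_neg]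
            exact ENNReal.inv_le_inv.2 (ENNReal.rpow_le_rpow (hcV x) hβ0.le)
      _ = _ := by
          rw [← ENNReal.ofReal_mul (by positivity), ← ENNReal.ofReal_mul (by positivity),
            Real.mul_rpow hc.le hx.le, neg_sub, Real.rpow_sub hx, Real.rpow_neg hx.le]
          congr 1
          field_simp
  obtain ⟨v, hv⟩ := hneg
  refine ⟨Measurable.aestronglyMeasurable (by fun_prop), ?_⟩
  have hsum : ∫⁻ x, (ENNReal.ofReal (Real.log ‖v‖ - Real.log ‖x‖) +
      (ENNReal.ofReal (Real.log (1 + ‖x‖)) + ENNReal.ofReal |Real.log ‖v‖|)) ∂μ < ⊤ := by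
    rw [lintegral_add_left (by fun_prop), lintegral_add_left (by fun_prop), lintegral_const]
    simp only [measure_univ, mul_one]
    exact ENNReal.add_lt_top.2 ⟨hv.lt_top, ENNReal.add_lt_top.2 ⟨hposi.lt_top, by simp⟩⟩
  refine lt_of_le_of_lt (lintegral_mono fun x => ?_) hsum
  have hl : 0 ≤ Real.log (1 + ‖x‖) := Real.log_nonneg (by linarith [norm_nonneg x])
  have hl2 : Real.log ‖x‖ ≤ Real.log (1 + ‖x‖) := by
    rcases eq_or_ne x 0 with rfl | hx0
    · simp
    · exact Real.log_le_log (norm_pos_iff.2 hx0) (by linarith)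
  rw [← ENNReal.ofReal_add hl (abs_nonneg _), Real.enorm_eq_ofReal_abs]
  rcases le_total 0 (Real.log ‖x‖) with h | h
  · refine le_add_left (ENNReal.ofReal_le_ofReal ?_)
    rw [abs_of_nonneg h]
    linarith [abs_nonneg (Real.log ‖v‖)]
  · refine le_trans (ENNReal.ofReal_le_ofReal ?_) ENNReal.ofReal_add_le
    rw [abs_of_nonpos h]
    linarith [neg_abs_le (Real.log ‖v‖)]

/-- Sublevel sets of `V` of comparable level are contained in a ball whose radius is
controlled by the geometric mean of the norm. -/
theorem ConvexOn.norm_le_mul_exp_integral_log_norm [Nontrivial E] {V : E → ℝ≥0∞} {β : ℝ}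
    (hβ : (finrank ℝ E : ℝ) < β) (hpos : ∀ x, 0 < V x) (hV : ConvexOn ℝ≥0 univ V)
    (hm : Measurable V) (h1 : ∫⁻ x, V x ^ (-β) ∂ν = 1) {K : ℝ≥0∞} (hK1 : 1 ≤ K) (hK : K ≠ ⊤)
    {v : E} (hv : ∀ x, V v ≤ K * V x) :
    ‖v‖ ≤ Real.exp (negLogConst (finrank ℝ E) β K).toReal *
      Real.exp (∫ x, Real.log ‖x‖ ∂ν.withDensity fun x => V x ^ (-β)) := by
  have hβ0 : 0 ≤ β := (Nat.cast_nonneg _).trans hβ.le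
  rcases eq_or_ne v 0 with rfl | hv0
  · rw [norm_zero]; positivity
  have := isProbabilityMeasure_withDensity_of_lintegral_eq_one h1
  have hi := hV.integrable_log_norm hβ hpos hm h1
  have h := hV.lintegral_log_sub_log_norm_le hβ0 hpos hm h1 hK1 hK hv0 hv
  set μ := ν.withDensity fun x => V x ^ (-β) with hμ
  have h2 : ∫ x, (Real.log ‖v‖ - Real.log ‖x‖) ∂μ ≤
      (negLogConst (finrank ℝ E) β K).toReal := by
    have hd : Integrable (fun x => Real.log ‖v‖ - Real.log ‖x‖) μ := (integrable_const _).sub hi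
    rw [integral_eq_lintegral_pos_part_sub_lintegral_neg_part hd]
    refine (sub_le_self _ ENNReal.toReal_nonneg).trans
      (ENNReal.toReal_mono (negLogConst_ne_top _ hβ0 hK) ?_)
    refine le_trans (le_of_eq ?_) h
    rw [hμ, lintegral_withDensity_eq_lintegral_mul _ (by fun_prop) (by fun_prop)]
    simp only [Pi.mul_apply, mul_comm]
  rw [integral_sub (integrable_const _) hi, integral_const] at h2
  simp only [probReal_univ, one_smul] at h2
  rw [← Real.exp_add]
  nth_rewrite 1 [← Real.exp_log (norm_pos_iff.2 hv0)]
  exact Real.exp_le_exp.2 (by linarith)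

end ConvexPowerDensity

/-! ### Mass of sublevel sets and integrals over segments -/

section ConvexPowerDensity

open Module Filter Topology

theorem ENNReal.sq_lintegral_mul_le {α : Type*} [MeasurableSpace α] (μ : Measure α)
    {f g : α → ℝ≥0∞} (hf : AEMeasurable f μ) (hg : AEMeasurable g μ) :
    (∫⁻ a, f a * g a ∂μ) ^ 2 ≤ (∫⁻ a, f a ^ 2 ∂μ) * ∫⁻ a, g a ^ 2 ∂μ := by
  have h := ENNReal.lintegral_mul_le_Lp_mul_Lq μ Real.HolderConjugate.two_two hf hg
  calc (∫⁻ a, f a * g a ∂μ) ^ 2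
      ≤ ((∫⁻ a, f a ^ (2 : ℝ) ∂μ) ^ (1 / 2 : ℝ) * (∫⁻ a, g a ^ (2 : ℝ) ∂μ) ^ (1 / 2 : ℝ)) ^ 2 := by
        gcongr
        exact h
    _ = _ := by
        rw [mul_pow, ← ENNReal.rpow_natCast, ← ENNReal.rpow_natCast, ← ENNReal.rpow_mul,
          ← ENNReal.rpow_mul]
        norm_num

theorem ENNReal.add_sq_le_two_mul (a b : ℝ≥0∞) : (a + b) ^ 2 ≤ 2 * a ^ 2 + 2 * b ^ 2 := by
  have h := ENNReal.rpow_add_le_mul_rpow_add_rpow a b (p := 2) (by norm_num)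
  norm_num at h
  rwa [mul_add] at h

theorem lintegral_Ioo_ofReal_rpow_ne_top {r : ℝ} (hr : -1 < r) :
    ∫⁻ s in Ioo (0 : ℝ) 1, ENNReal.ofReal (s ^ r) ≠ ⊤ := by
  have h := intervalIntegral.intervalIntegrable_rpow' (a := 0) (b := 1) hr
  rw [intervalIntegrable_iff_integrableOn_Ioo_of_le zero_le_one] at h
  exact h.lintegral_lt_top.ne

theorem mul_volume_setOf_mul_le {a D : ℝ} (ha : 0 ≤ a) (b : ℝ) :
    ENNReal.ofReal a * volume {s | s ∈ Ioo 0 b ∧ s * a ≤ D} ≤ ENNReal.ofReal D := by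
  rcases ha.eq_or_lt with rfl | ha
  · simp
  · have : {s | s ∈ Ioo 0 b ∧ s * a ≤ D} ⊆ Icc 0 (D / a) := fun s hs =>
      ⟨hs.1.1.le, (le_div_iff₀ ha).2 hs.2⟩
    calc _ ≤ ENNReal.ofReal a * volume (Icc 0 (D / a)) := by gcongr
      _ = ENNReal.ofReal D := by
        rw [Real.volume_Icc, ← ENNReal.ofReal_mul ha.le, sub_zero, mul_div_cancel₀ _ ha.ne']

theorem exists_one_le_rpow_mul_two_pow_lt_one {d : ℕ} {β : ℝ} (h : (d : ℝ) < β) :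
    ∃ K : ℝ, 1 ≤ K ∧ ((1 + K⁻¹) / 2) ^ β * 2 ^ d < 1 := by
  have hlim : Tendsto (fun K : ℝ => ((1 + K⁻¹) / 2) ^ β * 2 ^ d) atTop
      (𝓝 (((1 + 0) / 2) ^ β * 2 ^ d)) := by
    refine Tendsto.mul_const _ (Tendsto.rpow_const ?_ (Or.inl (by norm_num)))
    exact (tendsto_const_nhds.add tendsto_inv_atTop_zero).div_const 2
  have hlt : ((1 + 0) / 2 : ℝ) ^ β * 2 ^ d < 1 := by
    rw [add_zero, one_div, Real.inv_rpow (by norm_num), ← Real.rpow_natCast, ← Real.rpow_neg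
      (by norm_num), ← Real.rpow_add (by norm_num)]
    exact Real.rpow_lt_one_of_one_lt_of_neg (by norm_num) (by linarith)
  obtain ⟨K, h1, h2⟩ := ((eventually_ge_atTop 1).and (hlim.eventually_lt_const hlt)).exists
  exact ⟨K, h1, h2⟩

variable {E : Type*} [NormedAddCommGroup E] [NormedSpace ℝ E]
  [FiniteDimensional ℝ E] [MeasurableSpace E] [BorelSpace E]
  {ν : Measure E} [ν.IsAddHaarMeasure]

/-- A fixed fraction of the mass of `V ^ (-β)` lies in the sublevel set `{V ≤ K V x₀}` of a near
minimizer `x₀`: contraction by `1/2` towards `x₀` multiplies the mass of the complement by a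
factor larger than one. -/
theorem ConvexOn.rpow_le_mul_measure_sublevel {V : E → ℝ≥0∞} {β : ℝ} (hβ : 0 ≤ β)
    (hpos : ∀ x, 0 < V x) (hV : ConvexOn ℝ≥0 univ V)
    (hm : Measurable V) (h1 : ∫⁻ x, V x ^ (-β) ∂ν = 1) {K : ℝ} (hK : 1 ≤ K)
    {x₀ : E} (hx₀ : V x₀ ≠ ⊤) (hmin : ∀ x, V x₀ ≤ 2 * V x) :
    ENNReal.ofReal (1 - ((1 + K⁻¹) / 2) ^ β * 2 ^ finrank ℝ E) * V x₀ ^ β ≤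
      2 ^ β * ν {x | V x ≤ ENNReal.ofReal K * V x₀} := by
  set d := finrank ℝ E
  set w := V x₀ with hw
  set B := {x | V x ≤ ENNReal.ofReal K * w} with hB
  have hBm : MeasurableSet B := measurableSet_le hm measurable_const
  have hK0 : 0 < K := by linarith
  have hw0 : w ≠ 0 := (hpos x₀).ne'
  set κ := (1 + K⁻¹) / 2 with hκ
  have hκ0 : 0 < κ := by positivity
  have hout : ∫⁻ x in Bᶜ, V x ^ (-β) ∂ν ≤ ENNReal.ofReal (κ ^ β * 2 ^ d) := by
    have hp : ∀ x ∈ Bᶜ, V x ^ (-β) ≤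
        ENNReal.ofReal κ ^ β * V (x₀ + (1 / 2 : ℝ) • (x - x₀)) ^ (-β) := by
      intro x hx
      have hx : ENNReal.ofReal K * w < V x := by simpa [hB] using hx
      refine ENNReal.rpow_neg_le_mul_rpow_neg hβ (hpos x).ne' (by simpa using hκ0) (by simp) ?_
      refine (hV.le_add_smul_sub x₀ x (by norm_num) (by norm_num)).trans ?_
      have hwK : w ≤ ENNReal.ofReal K⁻¹ * V x := by
        calc w = ENNReal.ofReal K⁻¹ * (ENNReal.ofReal K * w) := by
              rw [← mul_assoc, ← ENNReal.ofReal_mul (by positivity), inv_mul_cancel₀ hK0.ne']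
              simp
          _ ≤ _ := by gcongr
      calc ENNReal.ofReal (1 - 1 / 2) * w + ENNReal.ofReal (1 / 2) * V x
          ≤ ENNReal.ofReal (1 - 1 / 2) * (ENNReal.ofReal K⁻¹ * V x) +
            ENNReal.ofReal (1 / 2) * V x := by gcongr
        _ = ENNReal.ofReal κ * V x := by
          rw [← mul_assoc, ← add_mul, ← ENNReal.ofReal_mul (by norm_num),
            ← ENNReal.ofReal_add (by positivity) (by norm_num), hκ]
          congr 2
          ring
    calc ∫⁻ x in Bᶜ, V x ^ (-β) ∂ν
        ≤ ∫⁻ x in Bᶜ, ENNReal.ofReal κ ^ β * V (x₀ + (1 / 2 : ℝ) • (x - x₀)) ^ (-β) ∂ν :=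
          setLIntegral_mono' hBm.compl hp
      _ ≤ ∫⁻ x, ENNReal.ofReal κ ^ β * V (x₀ + (1 / 2 : ℝ) • (x - x₀)) ^ (-β) ∂ν :=
          setLIntegral_le_lintegral _ _
      _ = ENNReal.ofReal (κ ^ β * 2 ^ d) := by
          rw [lintegral_const_mul _ (by fun_prop), lintegral_comp_homothety ν
            (fun x => V x ^ (-β)) x₀ (by norm_num : (0 : ℝ) < 1 / 2), h1, mul_one,
            ENNReal.ofReal_rpow_of_pos hκ0, ← ENNReal.ofReal_mul (by positivity)]
          congr 2
          rw [one_div, inv_pow, inv_inv]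
  have hin : ∫⁻ x in B, V x ^ (-β) ∂ν ≤ 2 ^ β * w ^ (-β) * ν B := by
    rw [← setLIntegral_const]
    exact lintegral_mono fun x =>
      ENNReal.rpow_neg_le_mul_rpow_neg hβ (hpos x).ne' (by simp) (by simp) (hmin x)
  have hsum : 1 ≤ 2 ^ β * w ^ (-β) * ν B + ENNReal.ofReal (κ ^ β * 2 ^ d) := by
    rw [← h1, ← lintegral_add_compl _ hBm]
    exact add_le_add hin hout
  have hle : ENNReal.ofReal (1 - κ ^ β * 2 ^ d) ≤ 2 ^ β * w ^ (-β) * ν B := by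
    rw [ENNReal.ofReal_sub _ (by positivity), ENNReal.ofReal_one]
    exact tsub_le_iff_right.2 hsum
  calc ENNReal.ofReal (1 - κ ^ β * 2 ^ d) * w ^ β
      ≤ 2 ^ β * w ^ (-β) * ν B * w ^ β := by gcongr
    _ = 2 ^ β * ν B * (w ^ (-β) * w ^ β) := by ring
    _ = _ := by rw [← ENNReal.rpow_add _ _ hw0 hx₀]; simp

/-- Weighted Cauchy-Schwarz along the segments from `y`, for path integrals over the
portions where the density at the endpoint `x` is at most `M s ^ β` times the density at the point
`y + s (x - y)`. The substitution `z = y + s (x - y)` costs `s ^ (-d)`, and `|x - y| = |z - y| / s`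
costs `s ^ (-2)`; the weight `s ^ (1 - (β - d) / 2)` makes both resulting integrals in `s`
convergent. -/
theorem lintegral_sq_segment_le {β : ℝ} (hβ : (finrank ℝ E : ℝ) < β) {p : E → ℝ≥0∞} (hp : Measurable p)
    {G : ℝ → E → ℝ≥0∞} (hG : Measurable (Function.uncurry G)) {H : E → ℝ≥0∞}
    (hH : Measurable H) (hGH : ∀ s z, G s z ≤ H z) {M : ℝ≥0∞} (y : E)
    (hpG : ∀ s ∈ Ioo (0 : ℝ) 1, ∀ x, G s (y + s • (x - y)) ≠ 0 →
      p x ≤ M * ENNReal.ofReal (s ^ β) * p (y + s • (x - y))) :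
    ∫⁻ x, (∫⁻ s in Ioo (0 : ℝ) 1, G s (y + s • (x - y)) * ‖x - y‖ₑ) ^ 2 * p x ∂ν ≤
      (∫⁻ s in Ioo (0 : ℝ) 1, ENNReal.ofReal (s ^ ((β - finrank ℝ E) / 2 - 1))) ^ 2 * M *
        ∫⁻ z, H z ^ 2 * ‖z - y‖ₑ ^ 2 * p z ∂ν := by
  set d := finrank ℝ E
  set γ := (β - d) / 2 - 1 with hγ
  set J := ∫⁻ s in Ioo (0 : ℝ) 1, ENNReal.ofReal (s ^ γ) with hJ
  set N := ∫⁻ z, H z ^ 2 * ‖z - y‖ₑ ^ 2 * p z ∂ν with hN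
  have hGm : Measurable fun q : E × ℝ => G q.2 (y + q.2 • (q.1 - y)) :=
    hG.comp (f := fun q : E × ℝ => (q.2, y + q.2 • (q.1 - y))) (by fun_prop)
  have hGm' : ∀ x, Measurable fun s : ℝ => G s (y + s • (x - y)) := fun x =>
    hGm.comp (g := fun q : E × ℝ => G q.2 (y + q.2 • (q.1 - y))) (f := fun s => (x, s))
      (by fun_prop)
  have cs : ∀ x, (∫⁻ s in Ioo (0 : ℝ) 1, G s (y + s • (x - y)) * ‖x - y‖ₑ) ^ 2 ≤
      J * ∫⁻ s in Ioo (0 : ℝ) 1,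
        ENNReal.ofReal (s ^ (-γ)) * (G s (y + s • (x - y)) * ‖x - y‖ₑ) ^ 2 := by
    intro x
    have h := ENNReal.sq_lintegral_mul_le (volume.restrict (Ioo (0 : ℝ) 1))
      (f := fun s => ENNReal.ofReal (s ^ (γ / 2)))
      (g := fun s => ENNReal.ofReal (s ^ (-γ / 2)) * (G s (y + s • (x - y)) * ‖x - y‖ₑ))
      (Measurable.aemeasurable (by fun_prop))
      (Measurable.aemeasurable (Measurable.mul (by fun_prop) ((hGm' x).mul_const _)))
    convert h using 1
    · congr 1
      refine setLIntegral_congr_fun measurableSet_Ioo fun s hs => ?_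
      rw [← mul_assoc, ← ENNReal.ofReal_mul (Real.rpow_nonneg hs.1.le _), ← Real.rpow_add hs.1]
      ring_nf
      simp
    · congr 1
      · refine setLIntegral_congr_fun measurableSet_Ioo fun s hs => ?_
        rw [← ENNReal.ofReal_pow (Real.rpow_nonneg hs.1.le _), ← Real.rpow_natCast,
          ← Real.rpow_mul hs.1.le]
        congr 2
        push_cast
        ring
      · refine setLIntegral_congr_fun measurableSet_Ioo fun s hs => ?_
        rw [mul_pow (ENNReal.ofReal _), ← ENNReal.ofReal_pow (Real.rpow_nonneg hs.1.le _),
          ← Real.rpow_natCast (s ^ _), ← Real.rpow_mul hs.1.le]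
        congr 3
        push_cast
        ring
  have sub : ∀ s ∈ Ioo (0 : ℝ) 1,
      ∫⁻ x, ENNReal.ofReal (s ^ (-γ)) * (G s (y + s • (x - y)) * ‖x - y‖ₑ) ^ 2 * p x ∂ν ≤
        ENNReal.ofReal (s ^ γ) * (M * N) := by
    intro s hs
    have hs0 := hs.1
    set c := ENNReal.ofReal (s ^ (-γ)) * (M * ENNReal.ofReal (s ^ β)) *
      ENNReal.ofReal (s ^ (-2 : ℝ)) with hc
    have hptw : ∀ x, ENNReal.ofReal (s ^ (-γ)) * (G s (y + s • (x - y)) * ‖x - y‖ₑ) ^ 2 * p x ≤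
        c * (H (y + s • (x - y)) ^ 2 * ‖(y + s • (x - y)) - y‖ₑ ^ 2 * p (y + s • (x - y))) := by
      intro x
      rcases eq_or_ne (G s (y + s • (x - y))) 0 with h0 | h0
      · simp [h0]
      have hn : ‖x - y‖ₑ ^ 2 =
          ENNReal.ofReal (s ^ (-2 : ℝ)) * ‖(y + s • (x - y)) - y‖ₑ ^ 2 := by
        rw [add_sub_cancel_left, enorm_smul, mul_pow, ← mul_assoc, Real.enorm_of_nonneg hs0.le,
          ← ENNReal.ofReal_pow hs0.le, ← ENNReal.ofReal_mul (Real.rpow_nonneg hs0.le _),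
          ← Real.rpow_natCast, ← Real.rpow_add hs0]
        norm_num
      calc ENNReal.ofReal (s ^ (-γ)) * (G s (y + s • (x - y)) * ‖x - y‖ₑ) ^ 2 * p x
          ≤ ENNReal.ofReal (s ^ (-γ)) * (H (y + s • (x - y)) * ‖x - y‖ₑ) ^ 2 *
            (M * ENNReal.ofReal (s ^ β) * p (y + s • (x - y))) := by
            gcongr
            · exact hGH _ _
            · exact hpG s hs x h0
        _ = _ := by
            rw [mul_pow, hn, hc]
            ring
    calc _ ≤ ∫⁻ x, c * (H (y + s • (x - y)) ^ 2 * ‖(y + s • (x - y)) - y‖ₑ ^ 2 *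
          p (y + s • (x - y))) ∂ν := lintegral_mono hptw
      _ = c * (ENNReal.ofReal ((s ^ d)⁻¹) * N) := by
          rw [lintegral_const_mul _ (by fun_prop), lintegral_comp_homothety ν
            (fun z => H z ^ 2 * ‖z - y‖ₑ ^ 2 * p z) y hs0]
      _ = (ENNReal.ofReal (s ^ (-γ)) * ENNReal.ofReal (s ^ β) * ENNReal.ofReal (s ^ (-2 : ℝ)) *
            ENNReal.ofReal ((s ^ d)⁻¹)) * (M * N) := by
          rw [hc]; ring
      _ = _ := by
          have hs' := fun r : ℝ => Real.rpow_nonneg hs0.le r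
          rw [← Real.rpow_natCast, ← Real.rpow_neg hs0.le, ← ENNReal.ofReal_mul (hs' _),
            ← ENNReal.ofReal_mul (by positivity), ← ENNReal.ofReal_mul (by positivity),
            ← Real.rpow_add hs0, ← Real.rpow_add hs0, ← Real.rpow_add hs0, hγ]
          congr 3
          ring
  have hJtop : J ≠ ⊤ := lintegral_Ioo_ofReal_rpow_ne_top (by rw [hγ]; linarith)
  calc _ ≤ ∫⁻ x, J * (∫⁻ s in Ioo (0 : ℝ) 1,
        ENNReal.ofReal (s ^ (-γ)) * (G s (y + s • (x - y)) * ‖x - y‖ₑ) ^ 2 * p x) ∂ν := by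
        refine lintegral_mono fun x => ?_
        refine (mul_le_mul' (cs x) le_rfl).trans (le_of_eq ?_)
        rw [mul_assoc, lintegral_mul_const]
        exact Measurable.mul (by fun_prop) (((hGm' x).mul_const _).pow_const 2)
    _ = J * ∫⁻ s in Ioo (0 : ℝ) 1, ∫⁻ x,
        ENNReal.ofReal (s ^ (-γ)) * (G s (y + s • (x - y)) * ‖x - y‖ₑ) ^ 2 * p x ∂ν := by
        rw [lintegral_const_mul' _ _ hJtop, lintegral_lintegral_swap]
        refine Measurable.aemeasurable ?_
        simp only [Function.uncurry_def]
        exact Measurable.mul (Measurable.mul (by fun_prop)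
          ((hGm.mul (by fun_prop)).pow_const 2)) (by fun_prop)
    _ ≤ J * ∫⁻ s in Ioo (0 : ℝ) 1, ENNReal.ofReal (s ^ γ) * (M * N) := by
        gcongr 1
        exact setLIntegral_mono' measurableSet_Ioo sub
    _ = _ := by
        rw [lintegral_mul_const _ (by fun_prop)]
        ring

/-- Cauchy-Schwarz along the initial halves of the segments from `y ∈ B` to a fixed endpoint `x`,
for path integrals of a function supported within distance `D` of every point of `B`. Only a
portion of length `D` of each segment contributes, which makes the bound independent of `x`. -/
theorem lintegral_sq_initial_segment_le {B : Set E} {G : E → ℝ≥0∞} (hG : Measurable G) {D : ℝ}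
    (hD : ∀ y ∈ B, ∀ z, G z ≠ 0 → ‖z - y‖ ≤ D) (hB : MeasurableSet B) (x : E) :
    ∫⁻ y in B, (∫⁻ s in Ioo (0 : ℝ) (1 / 2), G (y + s • (x - y)) * ‖x - y‖ₑ) ^ 2 ∂ν ≤
      2 ^ (finrank ℝ E + 1) * ENNReal.ofReal D ^ 2 * ∫⁻ z, G z ^ 2 ∂ν := by
  classical
  set d := finrank ℝ E
  set χ : ℝ → ℝ → ℝ≥0∞ := fun s a => if s * a ≤ D then 1 else 0 with hχ
  have hχm : Measurable (Function.uncurry χ) := by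
    refine Measurable.ite ?_ measurable_const measurable_const
    exact measurableSet_le (by fun_prop) measurable_const
  have hχ' : ∀ a : ℝ, Measurable fun s => χ s a := fun a =>
    hχm.comp (g := Function.uncurry χ) (f := fun s => (s, a)) (by fun_prop)
  have hvol : ∀ v : E, ‖v‖ₑ * ∫⁻ s in Ioo (0 : ℝ) (1 / 2), χ s ‖v‖ ≤ ENNReal.ofReal D := by
    intro v
    refine le_trans (le_of_eq ?_) (mul_volume_setOf_mul_le (D := D) (norm_nonneg v) (1 / 2))
    rw [ofReal_norm]
    congr 1
    have hSm : MeasurableSet {s : ℝ | s * ‖v‖ ≤ D} :=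
      measurableSet_le (by fun_prop) measurable_const
    have : (fun s => χ s ‖v‖) = {s : ℝ | s * ‖v‖ ≤ D}.indicator 1 := by
      funext s
      simp [hχ, indicator_apply]
    rw [this, lintegral_indicator_one hSm, Measure.restrict_apply hSm]
    congr 1
    ext s
    exact and_comm
  set F : ℝ → E → ℝ≥0∞ := fun s z => 2 * G z ^ 2 * (‖z - x‖ₑ * χ s ‖z - x‖) with hF
  have hFm : Measurable (Function.uncurry F) := by
    simp only [hF, Function.uncurry_def]
    refine Measurable.mul (by fun_prop) (Measurable.mul (by fun_prop) ?_)
    exact hχm.comp (g := Function.uncurry χ) (f := fun q : ℝ × E => (q.1, ‖q.2 - x‖))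
      (by fun_prop)
  have cs : ∀ y ∈ B, (∫⁻ s in Ioo (0 : ℝ) (1 / 2), G (y + s • (x - y)) * ‖x - y‖ₑ) ^ 2 ≤
      ENNReal.ofReal D * ∫⁻ s in Ioo (0 : ℝ) (1 / 2), F s (x + (1 - s) • (y - x)) := by
    intro y hy
    have hz : ∀ s : ℝ, y + s • (x - y) = x + (1 - s) • (y - x) := fun s => by module
    have e1 : ∫⁻ s in Ioo (0 : ℝ) (1 / 2), G (y + s • (x - y)) * ‖x - y‖ₑ =
        (∫⁻ s in Ioo (0 : ℝ) (1 / 2), χ s ‖x - y‖ * (χ s ‖x - y‖ * G (y + s • (x - y)))) *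
          ‖x - y‖ₑ := by
      rw [← lintegral_mul_const' _ _ enorm_ne_top]
      refine setLIntegral_congr_fun measurableSet_Ioo fun s hs => ?_
      rcases eq_or_ne (G (y + s • (x - y))) 0 with h0 | h0
      · simp [h0]
      · have h := hD y hy _ h0
        rw [add_sub_cancel_left, norm_smul, Real.norm_of_nonneg hs.1.le] at h
        simp [hχ, h]
    have hsq : ∀ s a, χ s a ^ 2 = χ s a := by
      intro s a
      by_cases h : s * a ≤ D <;> simp [hχ, h]
    calc _ = (∫⁻ s in Ioo (0 : ℝ) (1 / 2),
          χ s ‖x - y‖ * (χ s ‖x - y‖ * G (y + s • (x - y)))) ^ 2 * ‖x - y‖ₑ ^ 2 := by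
          rw [e1, mul_pow]
      _ ≤ ((∫⁻ s in Ioo (0 : ℝ) (1 / 2), χ s ‖x - y‖ ^ 2) *
          ∫⁻ s in Ioo (0 : ℝ) (1 / 2), (χ s ‖x - y‖ * G (y + s • (x - y))) ^ 2) *
            ‖x - y‖ₑ ^ 2 := by
          gcongr
          exact ENNReal.sq_lintegral_mul_le _ (hχ' _).aemeasurable
            ((hχ' _).mul (by fun_prop)).aemeasurable
      _ = (‖x - y‖ₑ * ∫⁻ s in Ioo (0 : ℝ) (1 / 2), χ s ‖x - y‖) *
          ∫⁻ s in Ioo (0 : ℝ) (1 / 2), χ s ‖x - y‖ * G (y + s • (x - y)) ^ 2 * ‖x - y‖ₑ := by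
          rw [lintegral_mul_const' _ _ enorm_ne_top]
          simp only [mul_pow, hsq]
          ring
      _ ≤ ENNReal.ofReal D * ∫⁻ s in Ioo (0 : ℝ) (1 / 2), F s (x + (1 - s) • (y - x)) := by
          refine mul_le_mul' (hvol _) (setLIntegral_mono' measurableSet_Ioo fun s hs => ?_)
          have hs1 : (1 / 2 : ℝ) ≤ 1 - s := by linarith [hs.2]
          have hnz : ‖x + (1 - s) • (y - x) - x‖ = (1 - s) * ‖x - y‖ := by
            rw [add_sub_cancel_left, norm_smul, Real.norm_of_nonneg (by linarith), norm_sub_rev]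
          have hχle : χ s ‖x - y‖ ≤ χ s ‖x + (1 - s) • (y - x) - x‖ := by
            by_cases h : s * ‖x - y‖ ≤ D
            · have h' : s * ‖x + (1 - s) • (y - x) - x‖ ≤ D := by
                refine le_trans (mul_le_mul_of_nonneg_left ?_ hs.1.le) h
                rw [hnz]
                exact mul_le_of_le_one_left (norm_nonneg _) (by linarith [hs.1])
              simp only [hχ, if_pos h, if_pos h', le_refl]
            · simp [hχ, h]
          have hnle : ‖x - y‖ₑ ≤ 2 * ‖x + (1 - s) • (y - x) - x‖ₑ := by
            rw [← ofReal_norm, ← ofReal_norm, hnz,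
              show (2 : ℝ≥0∞) = ENNReal.ofReal 2 by simp, ← ENNReal.ofReal_mul (by norm_num)]
            refine ENNReal.ofReal_le_ofReal ?_
            nlinarith [norm_nonneg (x - y)]
          rw [hz s]
          calc _ ≤ χ s ‖x + (1 - s) • (y - x) - x‖ * G (x + (1 - s) • (y - x)) ^ 2 *
                (2 * ‖x + (1 - s) • (y - x) - x‖ₑ) := by gcongr
            _ = _ := by
              simp only [hF]
              ring
  have hsub : ∀ s ∈ Ioo (0 : ℝ) (1 / 2),
      ∫⁻ y, F s (x + (1 - s) • (y - x)) ∂ν ≤ 2 ^ d * ∫⁻ z, F s z ∂ν := by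
    intro s hs
    have hs1 : (1 / 2 : ℝ) ≤ 1 - s := by linarith [hs.2]
    rw [lintegral_comp_homothety ν (F s) x (by linarith : 0 < 1 - s)]
    gcongr
    rw [← inv_pow]
    calc ENNReal.ofReal ((1 - s)⁻¹ ^ d) ≤ ENNReal.ofReal (2 ^ d) := by
          refine ENNReal.ofReal_le_ofReal (pow_le_pow_left₀ (inv_nonneg.2 (by linarith)) ?_ _)
          rw [inv_le_comm₀ (by linarith) (by norm_num)]
          linarith
      _ = 2 ^ d := by rw [ENNReal.ofReal_pow (by norm_num)]; simp
  calc _ ≤ ∫⁻ y in B, ENNReal.ofReal D *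
        (∫⁻ s in Ioo (0 : ℝ) (1 / 2), F s (x + (1 - s) • (y - x))) ∂ν :=
        setLIntegral_mono' hB cs
    _ ≤ ∫⁻ y, ENNReal.ofReal D *
        (∫⁻ s in Ioo (0 : ℝ) (1 / 2), F s (x + (1 - s) • (y - x))) ∂ν :=
        setLIntegral_le_lintegral _ _
    _ = ENNReal.ofReal D * ∫⁻ s in Ioo (0 : ℝ) (1 / 2),
        ∫⁻ y, F s (x + (1 - s) • (y - x)) ∂ν := by
        rw [lintegral_const_mul' _ _ ENNReal.ofReal_ne_top, lintegral_lintegral_swap]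
        refine Measurable.aemeasurable ?_
        exact hFm.comp (g := Function.uncurry F)
          (f := fun q : E × ℝ => (q.2, x + (1 - q.2) • (q.1 - x))) (by fun_prop)
    _ ≤ ENNReal.ofReal D * ∫⁻ s in Ioo (0 : ℝ) (1 / 2), 2 ^ d * ∫⁻ z, F s z ∂ν :=
        mul_le_mul' le_rfl (setLIntegral_mono' measurableSet_Ioo hsub)
    _ = ENNReal.ofReal D * (2 ^ d * ∫⁻ z, (∫⁻ s in Ioo (0 : ℝ) (1 / 2), F s z) ∂ν) := by
        rw [lintegral_const_mul' _ _ (by simp), lintegral_lintegral_swap hFm.aemeasurable]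
    _ ≤ ENNReal.ofReal D * (2 ^ d * ∫⁻ z, 2 * ENNReal.ofReal D * G z ^ 2 ∂ν) := by
        gcongr with z
        simp only [hF]
        rw [lintegral_const_mul _ ((hχ' _).const_mul _), lintegral_const_mul _ (hχ' _)]
        calc _ ≤ 2 * G z ^ 2 * ENNReal.ofReal D := mul_le_mul' le_rfl (hvol _)
          _ = _ := by ring
    _ = _ := by
        rw [lintegral_const_mul _ (by fun_prop)]
        ring

end ConvexPowerDensity

/-! ### The weighted Poincaré inequality -/

section ConvexPowerDensity

open Module Filter Topology

theorem ofReal_variance_le_lintegral_sub_sq {Ω : Type*} [MeasurableSpace Ω] {μ : Measure Ω}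
    [IsProbabilityMeasure μ] {X : Ω → ℝ} (hX : AEStronglyMeasurable X μ) (c : ℝ) :
    ENNReal.ofReal (Var[X; μ]) ≤ ∫⁻ a, ‖X a - c‖ₑ ^ 2 ∂μ := by
  have hX' : AEStronglyMeasurable (fun a => X a - c) μ := hX.sub aestronglyMeasurable_const
  rw [← variance_sub_const hX c]
  refine (ENNReal.ofReal_le_ofReal (variance_le_expectation_sq hX')).trans ?_
  refine (ENNReal.ofReal_le_ofReal (le_abs_self _)).trans ?_
  rw [← Real.enorm_eq_ofReal_abs]
  refine (enorm_integral_le_lintegral_enorm _).trans (le_of_eq ?_)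
  simp [enorm_pow]

variable {E : Type*} [NormedAddCommGroup E] [NormedSpace ℝ E]

theorem enorm_sub_le_lintegral_segment {g : E → ℝ} (hg : ContDiff ℝ 1 g) (x y : E) :
    ‖g x - g y‖ₑ ≤
      ∫⁻ s in Ioo (0 : ℝ) 1, ‖fderiv ℝ g (y + s • (x - y))‖ₑ * ‖x - y‖ₑ := by
  have hd : ∀ s ∈ uIcc (0 : ℝ) 1, HasDerivAt (fun s : ℝ => g (y + s • (x - y)))
      (fderiv ℝ g (y + s • (x - y)) (x - y)) s := by
    intro s _
    have h1 : HasDerivAt (fun s : ℝ => y + s • (x - y)) (x - y) s := by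
      simpa using ((hasDerivAt_id s).smul_const (x - y)).const_add y
    exact ((hg.differentiable (by norm_num)) _).hasFDerivAt.comp_hasDerivAt s h1
  have hc : Continuous fun s : ℝ => fderiv ℝ g (y + s • (x - y)) (x - y) :=
    ((hg.continuous_fderiv (by norm_num)).comp (by fun_prop)).clm_apply continuous_const
  have h := intervalIntegral.integral_eq_sub_of_hasDerivAt hd (hc.intervalIntegrable 0 1)
  simp only [one_smul, add_sub_cancel, zero_smul, add_zero] at h
  rw [← h, intervalIntegral.integral_of_le zero_le_one, integral_Ioc_eq_integral_Ioo]
  refine (enorm_integral_le_lintegral_enorm _).trans (lintegral_mono fun s => ?_)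
  exact ContinuousLinearMap.le_opENorm _ _

/-- On the segment from `y ∈ {V ≤ K w}` to `x`, the values of `V` in the second half and outside
`{V ≤ 2 K w}` are at most of order `s V x`; this gains the factor `s ^ β` for the densities. -/
theorem ConvexOn.le_mul_mul_of_segment {V : E → ℝ≥0∞} (hV : ConvexOn ℝ≥0 univ V) {w : ℝ≥0∞}
    (hw : w ≠ ⊤) (hmin : ∀ x, w ≤ 2 * V x) {K : ℝ} (hK : 1 ≤ K) {x y : E}
    (hy : V y ≤ ENNReal.ofReal K * w) {s : ℝ} (hs : s ∈ Ioo (0 : ℝ) 1)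
    (h : 1 / 2 ≤ s ∨ ENNReal.ofReal (2 * K) * w < V (y + s • (x - y))) :
    V (y + s • (x - y)) ≤ ENNReal.ofReal ((4 * K + 2) * s) * V x := by
  have hz := hV.le_add_smul_sub y x hs.1.le hs.2.le
  have h1s : ENNReal.ofReal (1 - s) * V y ≤ ENNReal.ofReal K * w :=
    calc ENNReal.ofReal (1 - s) * V y ≤ 1 * V y := by
          gcongr
          exact ENNReal.ofReal_le_one.2 (by linarith [hs.1])
      _ ≤ _ := by rwa [one_mul]
  rcases h with h | h
  · calc _ ≤ ENNReal.ofReal K * (2 * V x) + ENNReal.ofReal 1 * V x := by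
          refine hz.trans (add_le_add (h1s.trans ?_) ?_)
          · gcongr
            exact hmin x
          · gcongr
            exact hs.2.le
      _ = ENNReal.ofReal (2 * K + 1) * V x := by
          rw [ENNReal.ofReal_add (by linarith) (by norm_num), ENNReal.ofReal_mul (by norm_num)]
          simp only [ENNReal.ofReal_ofNat]
          ring
      _ ≤ _ := by
          gcongr
          nlinarith
  · set u := ENNReal.ofReal K * w with hu
    have hutop : u ≠ ⊤ := ENNReal.mul_ne_top (by simp) hw
    have h2u : ENNReal.ofReal (2 * K) * w = u + u := by
      rw [ENNReal.ofReal_mul (by norm_num), hu]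
      simp only [ENNReal.ofReal_ofNat]
      ring
    have hzu : V (y + s • (x - y)) ≤ u + ENNReal.ofReal s * V x :=
      hz.trans (add_le_add h1s le_rfl)
    have hus : u ≤ ENNReal.ofReal s * V x := by
      have := h.le.trans hzu
      rw [h2u] at this
      exact (ENNReal.add_le_add_iff_left hutop).1 this
    calc _ ≤ ENNReal.ofReal s * V x + ENNReal.ofReal s * V x := hzu.trans (add_le_add hus le_rfl)
      _ = ENNReal.ofReal (2 * s) * V x := by
          rw [ENNReal.ofReal_mul (by norm_num)]
          simp only [ENNReal.ofReal_ofNat]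
          ring
      _ ≤ _ := by
          gcongr
          · exact hs.1.le
          · linarith

variable [FiniteDimensional ℝ E] [MeasurableSpace E] [BorelSpace E]

/-- Weighted Poincaré inequality for a Borel measurable convex `V`. The function `H` plays the
role of `|∇g|`, and only the bound for increments of `g` along segments is used. -/
theorem ConvexOn.exists_ofReal_variance_le [Nontrivial E] (ν : Measure E) [ν.IsAddHaarMeasure]
    {β : ℝ} (hβ : (finrank ℝ E : ℝ) < β) :
    ∃ C : ℝ≥0∞, C ≠ ⊤ ∧ ∀ V : E → ℝ≥0∞, (∀ x, 0 < V x) → ConvexOn ℝ≥0 univ V → Measurable V →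
      ∫⁻ x, V x ^ (-β) ∂ν = 1 → ∀ (g : E → ℝ) (H : E → ℝ≥0∞), Measurable g → Measurable H →
        (∀ x y, ‖g x - g y‖ₑ ≤ ∫⁻ s in Ioo (0 : ℝ) 1, H (y + s • (x - y)) * ‖x - y‖ₑ) →
        ENNReal.ofReal (Var[g; ν.withDensity fun x => V x ^ (-β)]) ≤
          C * ∫⁻ x, H x ^ 2 * ENNReal.ofReal
            (Real.exp (∫ x, Real.log ‖x‖ ∂ν.withDensity fun x => V x ^ (-β)) ^ 2 + ‖x‖ ^ 2) *
              V x ^ (-β) ∂ν := by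
  classical
  set d := finrank ℝ E with hd
  have hβ0 : 0 ≤ β := (Nat.cast_nonneg _).trans hβ.le
  obtain ⟨K, hK1, hKq⟩ := exists_one_le_rpow_mul_two_pow_lt_one hβ
  set θ := ENNReal.ofReal (1 - ((1 + K⁻¹) / 2) ^ β * 2 ^ d) with hθ
  have hθ0 : θ ≠ 0 := by
    rw [hθ, ne_eq, ENNReal.ofReal_eq_zero, not_le]
    linarith
  have hθtop : θ ≠ ⊤ := ENNReal.ofReal_ne_top
  set e := Real.exp (negLogConst d β (ENNReal.ofReal (4 * K))).toReal with he
  set Q := ENNReal.ofReal (4 * e ^ 2) with hQ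
  set J := ∫⁻ s in Ioo (0 : ℝ) 1, ENNReal.ofReal (s ^ ((β - d) / 2 - 1)) with hJ
  have hJtop : J ≠ ⊤ := lintegral_Ioo_ofReal_rpow_ne_top (by linarith)
  set M := ENNReal.ofReal (4 * K + 2) ^ β with hM
  set k := ENNReal.ofReal (2 * K) ^ β with hk
  refine ⟨2 * (J ^ 2 * M * Q) + 2 * (2 ^ (d + 1) * (Q * (k * (θ⁻¹ * 2 ^ β)))), ?_, ?_⟩
  · have hM' : M ≠ ⊤ := ENNReal.rpow_ne_top_of_nonneg hβ0 ENNReal.ofReal_ne_top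
    have hk' : k ≠ ⊤ := ENNReal.rpow_ne_top_of_nonneg hβ0 ENNReal.ofReal_ne_top
    have h2 : (2 : ℝ≥0∞) ^ β ≠ ⊤ := ENNReal.rpow_ne_top_of_nonneg hβ0 (by simp)
    have hQ' : Q ≠ ⊤ := ENNReal.ofReal_ne_top
    have hθi : θ⁻¹ ≠ ⊤ := ENNReal.inv_ne_top.2 hθ0
    finiteness
  intro V hpos hV hm h1 g H hg hH hgH
  have := isProbabilityMeasure_withDensity_of_lintegral_eq_one h1
  obtain ⟨x₀, hx₀, hmin⟩ := hV.exists_near_minimizer hβ hm h1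
  have hvolB := hV.rpow_le_mul_measure_sublevel hβ0 hpos hm h1 hK1 hx₀ hmin
  set μ := ν.withDensity fun x => V x ^ (-β) with hμ
  set m := Real.exp (∫ x, Real.log ‖x‖ ∂μ) with hm0
  set w := V x₀ with hw
  have hw0 : w ≠ 0 := (hpos x₀).ne'
  set c := ENNReal.ofReal (2 * K) * w with hc
  have hctop : c ≠ ⊤ := ENNReal.mul_ne_top ENNReal.ofReal_ne_top hx₀
  set B := {x | V x ≤ ENNReal.ofReal K * w} with hB
  have hBm : MeasurableSet B := measurableSet_le hm measurable_const
  set W : E → ℝ≥0∞ := fun x => ENNReal.ofReal (m ^ 2 + ‖x‖ ^ 2) with hW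
  set N := ∫⁻ x, H x ^ 2 * W x * V x ^ (-β) ∂ν with hN
  have hWm : Measurable W := by fun_prop
  have he0 : 0 < e := Real.exp_pos _
  have hmpos : 0 < m := Real.exp_pos _
  have hcB : ∀ y ∈ B, V y ≤ c := fun y hy => by
    refine le_trans hy ?_
    rw [hc]
    gcongr
    linarith
  have hrad : ∀ z, V z ≤ c → ‖z‖ ≤ e * m := by
    intro z hz
    refine hV.norm_le_mul_exp_integral_log_norm hβ hpos hm h1 (K := ENNReal.ofReal (4 * K))
      ?_ ENNReal.ofReal_ne_top fun x => ?_
    · rw [ENNReal.one_le_ofReal]; linarith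
    · calc V z ≤ ENNReal.ofReal (2 * K) * (2 * V x) := by
            refine hz.trans ?_
            rw [hc]
            gcongr
            exact hmin x
        _ = _ := by
            rw [show 4 * K = 2 * K * 2 by ring,
              ENNReal.ofReal_mul (show 0 ≤ 2 * K by linarith)]
            simp only [ENNReal.ofReal_ofNat]
            ring
  -- The part of the segment where the density dominates the density at the endpoint.
  set G : ℝ → E → ℝ≥0∞ := fun s z => if 1 / 2 ≤ s ∨ c < V z then H z else 0 with hG
  have hGm : Measurable (Function.uncurry G) := by
    refine Measurable.ite (MeasurableSet.union ?_ ?_) (by fun_prop) measurable_const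
    · exact measurableSet_le measurable_const measurable_fst
    · exact measurableSet_lt measurable_const (hm.comp measurable_snd)
  -- The remaining part, near `y` and inside a bounded sublevel set.
  set G' : E → ℝ≥0∞ := fun z => if V z ≤ c then H z else 0 with hG'
  have hG'm : Measurable G' :=
    Measurable.ite (measurableSet_le hm measurable_const) hH measurable_const
  set T : E → E → ℝ≥0∞ := fun y x =>
    ∫⁻ s in Ioo (0 : ℝ) 1, G s (y + s • (x - y)) * ‖x - y‖ₑ with hT
  set S : E → E → ℝ≥0∞ := fun y x =>
    ∫⁻ s in Ioo (0 : ℝ) (1 / 2), G' (y + s • (x - y)) * ‖x - y‖ₑ with hS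
  have hSm : Measurable (Function.uncurry S) := by
    refine Measurable.lintegral_prod_right' (f := fun q : (E × E) × ℝ =>
      G' (q.1.1 + q.2 • (q.1.2 - q.1.1)) * ‖q.1.2 - q.1.1‖ₑ) ?_
    fun_prop
  have hsplit : ∀ y x, ‖g x - g y‖ₑ ≤ T y x + S y x := by
    intro y x
    have hS' : S y x = ∫⁻ s in Ioo (0 : ℝ) 1,
        (Ioo (0 : ℝ) (1 / 2)).indicator (fun s => G' (y + s • (x - y)) * ‖x - y‖ₑ) s := by
      rw [setLIntegral_indicator measurableSet_Ioo, inter_eq_left.2]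
      exact Ioo_subset_Ioo_right (by norm_num)
    rw [hS', ← lintegral_add_right _
      (Measurable.indicator (by fun_prop) measurableSet_Ioo)]
    refine (hgH x y).trans (setLIntegral_mono' measurableSet_Ioo fun s hs => ?_)
    by_cases h : 1 / 2 ≤ s ∨ c < V (y + s • (x - y))
    · simp only [hG, if_pos h]
      exact le_self_add
    · push Not at h
      rw [indicator_of_mem (show s ∈ Ioo (0 : ℝ) (1 / 2) from ⟨hs.1, h.1⟩)]
      simp only [hG', if_pos h.2]
      exact le_add_self
  have htail : ∀ y ∈ B, ∫⁻ x, T y x ^ 2 * V x ^ (-β) ∂ν ≤ J ^ 2 * M * (Q * N) := by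
    intro y hy
    have h := lintegral_sq_segment_le (ν := ν) hβ (p := fun x => V x ^ (-β)) (by fun_prop) hGm hH
      (fun s z => by simp only [hG]; split_ifs <;> simp) (M := M) y (fun s hs x hne => by
        have hcond : 1 / 2 ≤ s ∨ c < V (y + s • (x - y)) := by
          by_contra hcon
          exact hne (by simp only [hG, if_neg hcon])
        have hs4 : 0 < (4 * K + 2) * s := mul_pos (by linarith) hs.1
        refine (ENNReal.rpow_neg_le_mul_rpow_neg hβ0 (hpos x).ne' (by simpa using hs4) (by simp)
          (hV.le_mul_mul_of_segment hx₀ hmin hK1 hy hs hcond)).trans (le_of_eq ?_)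
        rw [ENNReal.ofReal_mul (by linarith), ENNReal.mul_rpow_of_nonneg _ _ hβ0,
          ENNReal.ofReal_rpow_of_pos hs.1])
    refine h.trans (mul_le_mul' le_rfl ?_)
    rw [hN, ← lintegral_const_mul _ (by fun_prop)]
    refine lintegral_mono fun z => ?_
    have hzy : ‖z - y‖ₑ ^ 2 ≤ Q * W z := by
      rw [← ofReal_norm, ← ENNReal.ofReal_pow (norm_nonneg _), hQ, hW,
        ← ENNReal.ofReal_mul (by positivity)]
      refine ENNReal.ofReal_le_ofReal ?_
      have h1 := norm_sub_le z y
      have h2 := hrad y (hcB y hy)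
      have h3 : 1 ≤ e := Real.one_le_exp ENNReal.toReal_nonneg
      have h4 : ‖z - y‖ ^ 2 ≤ (‖z‖ + e * m) ^ 2 :=
        pow_le_pow_left₀ (norm_nonneg _) (by linarith) 2
      have h5 : ‖z‖ ^ 2 ≤ e ^ 2 * ‖z‖ ^ 2 :=
        le_mul_of_one_le_left (sq_nonneg _) (one_le_pow₀ h3)
      nlinarith [sq_nonneg (‖z‖ - e * m), sq_nonneg (e * m)]
    calc _ ≤ H z ^ 2 * (Q * W z) * V z ^ (-β) := by gcongr
      _ = _ := by ring
  have hbulk : ∀ x, ∫⁻ y in B, S y x ^ 2 ∂ν ≤ 2 ^ (d + 1) * (Q * (c ^ β * N)) := by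
    intro x
    have h := lintegral_sq_initial_segment_le (ν := ν) hG'm (B := B) (D := 2 * (e * m))
      (fun y hy z hz => by
        have hzc : V z ≤ c := by
          by_contra hcon
          exact hz (by simp only [hG', if_neg hcon])
        linarith [norm_sub_le z y, hrad y (hcB y hy), hrad z hzc]) hBm x
    refine h.trans ?_
    rw [mul_assoc]
    refine mul_le_mul' le_rfl ?_
    rw [hN, ← lintegral_const_mul _ (by fun_prop), ← lintegral_const_mul _ (by fun_prop),
      ← lintegral_const_mul _ (by fun_prop)]
    refine lintegral_mono fun z => ?_
    by_cases hz : V z ≤ c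
    · have hD : ENNReal.ofReal (2 * (e * m)) ^ 2 ≤ Q * W z := by
        rw [← ENNReal.ofReal_pow (by positivity), hQ, hW, ← ENNReal.ofReal_mul (by positivity)]
        refine ENNReal.ofReal_le_ofReal ?_
        have : 0 ≤ e ^ 2 * ‖z‖ ^ 2 := by positivity
        nlinarith
      have hone : 1 ≤ c ^ β * V z ^ (-β) := by
        calc (1 : ℝ≥0∞) = V z ^ β * V z ^ (-β) := by
              rw [← ENNReal.rpow_add _ _ (hpos z).ne' (ne_top_of_le_ne_top hctop hz)]
              simp
          _ ≤ _ := by gcongr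
      calc ENNReal.ofReal (2 * (e * m)) ^ 2 * G' z ^ 2
          ≤ (Q * W z) * H z ^ 2 * 1 := by
            rw [mul_one]
            simp only [hG', if_pos hz]
            gcongr
        _ ≤ (Q * W z) * H z ^ 2 * (c ^ β * V z ^ (-β)) := by gcongr
        _ = _ := by ring
    · simp [hG', hz]
  have hvar : ∀ y, ENNReal.ofReal (Var[g; μ]) ≤ ∫⁻ x, ‖g x - g y‖ₑ ^ 2 * V x ^ (-β) ∂ν := by
    intro y
    refine (ofReal_variance_le_lintegral_sub_sq hg.aestronglyMeasurable (g y)).trans (le_of_eq ?_)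
    rw [hμ, lintegral_withDensity_eq_lintegral_mul _ (by fun_prop) (by fun_prop)]
    simp only [Pi.mul_apply, mul_comm]
  have hBpos : ν B ≠ 0 := by
    intro h0
    rw [h0, mul_zero, nonpos_iff_eq_zero, mul_eq_zero] at hvolB
    rcases hvolB with h | h
    · exact hθ0 h
    · rcases ENNReal.rpow_eq_zero_iff.1 h with h | h
      · exact hw0 h.1
      · exact hx₀ h.1
  have hBtop : ν B ≠ ⊤ := by
    have hKw0 : ENNReal.ofReal K * w ≠ 0 := by
      refine mul_ne_zero ?_ hw0
      rw [ne_eq, ENNReal.ofReal_eq_zero]; linarith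
    have hKwt : ENNReal.ofReal K * w ≠ ⊤ := ENNReal.mul_ne_top (by simp) hx₀
    have h2 : (ENNReal.ofReal K * w) ^ (-β) * ν B ≤ 1 := by
      rw [← setLIntegral_const, ← h1]
      refine (setLIntegral_mono' hBm fun x hx => ?_).trans (setLIntegral_le_lintegral _ _)
      rw [ENNReal.rpow_neg, ENNReal.rpow_neg]
      exact ENNReal.inv_le_inv.2 (ENNReal.rpow_le_rpow hx hβ0)
    intro htop
    rw [htop, ENNReal.mul_top] at h2
    · simp at h2
    · rw [ne_eq, ENNReal.rpow_eq_zero_iff]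
      simp [hKw0, hKwt]
  have hcβ : c ^ β ≤ k * (θ⁻¹ * 2 ^ β) * ν B := by
    rw [hc, ENNReal.mul_rpow_of_nonneg _ _ hβ0]
    calc k * w ^ β = k * (θ⁻¹ * (θ * w ^ β)) := by
          rw [← mul_assoc θ⁻¹, ENNReal.inv_mul_cancel hθ0 hθtop, one_mul]
      _ ≤ k * (θ⁻¹ * (2 ^ β * ν B)) := by gcongr
      _ = _ := by ring
  have hmain : ν B * ENNReal.ofReal (Var[g; μ]) ≤ ν B *
      ((2 * (J ^ 2 * M * Q) + 2 * (2 ^ (d + 1) * (Q * (k * (θ⁻¹ * 2 ^ β))))) * N) := by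
    calc ν B * ENNReal.ofReal (Var[g; μ]) = ∫⁻ _ in B, ENNReal.ofReal (Var[g; μ]) ∂ν := by
          rw [setLIntegral_const, mul_comm]
      _ ≤ ∫⁻ y in B, (2 * (J ^ 2 * M * (Q * N)) +
            2 * ∫⁻ x, S y x ^ 2 * V x ^ (-β) ∂ν) ∂ν := by
          refine setLIntegral_mono' hBm fun y hy => (hvar y).trans ?_
          calc _ ≤ ∫⁻ x, (2 * (T y x ^ 2 * V x ^ (-β)) + 2 * (S y x ^ 2 * V x ^ (-β))) ∂ν := by
                refine lintegral_mono fun x => ?_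
                calc _ ≤ (2 * T y x ^ 2 + 2 * S y x ^ 2) * V x ^ (-β) := by
                      gcongr
                      exact (pow_le_pow_left₀ (zero_le) (hsplit y x) 2).trans
                        (ENNReal.add_sq_le_two_mul _ _)
                  _ = _ := by ring
            _ = 2 * ∫⁻ x, T y x ^ 2 * V x ^ (-β) ∂ν + 2 * ∫⁻ x, S y x ^ 2 * V x ^ (-β) ∂ν := by
                have hSy : Measurable (S y) := hSm.of_uncurry_left
                rw [lintegral_add_right _ (by fun_prop), lintegral_const_mul' _ _ (by simp),
                  lintegral_const_mul' _ _ (by simp)]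
            _ ≤ _ := by
                gcongr
                exact htail y hy
      _ = 2 * (J ^ 2 * M * (Q * N)) * ν B +
            2 * ∫⁻ x, (∫⁻ y in B, S y x ^ 2 ∂ν) * V x ^ (-β) ∂ν := by
          rw [lintegral_add_left measurable_const, setLIntegral_const,
            lintegral_const_mul' _ _ (by simp), lintegral_lintegral_swap]
          · congr 2
            refine lintegral_congr fun x => ?_
            have hSx : Measurable fun y => S y x := hSm.of_uncurry_right
            rw [lintegral_mul_const _ (by fun_prop)]
          · exact Measurable.aemeasurable ((hSm.pow_const 2).mul (by fun_prop))
      _ ≤ 2 * (J ^ 2 * M * (Q * N)) * ν B +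
            2 * ∫⁻ x, 2 ^ (d + 1) * (Q * (c ^ β * N)) * V x ^ (-β) ∂ν := by
          gcongr with x
          exact hbulk x
      _ = 2 * (J ^ 2 * M * (Q * N)) * ν B + 2 * (2 ^ (d + 1) * (Q * (c ^ β * N))) := by
          rw [lintegral_const_mul _ (by fun_prop), h1, mul_one]
      _ ≤ 2 * (J ^ 2 * M * (Q * N)) * ν B +
            2 * (2 ^ (d + 1) * (Q * (k * (θ⁻¹ * 2 ^ β) * ν B * N))) := by gcongr
      _ = _ := by ring
  exact (ENNReal.mul_le_mul_iff_right hBpos hBtop).1 hmain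

end ConvexPowerDensity

theorem HasConvexPowerDensity.exists_measurable {n : ℕ} {β : ℝ}
    {μ : Measure (EuclideanSpace ℝ (Fin n))} (h : HasConvexPowerDensity β μ) :
    ∃ V : EuclideanSpace ℝ (Fin n) → ℝ≥0∞, (∀ x, 0 < V x) ∧ ConvexOn ℝ≥0 univ V ∧
      Measurable V ∧ μ = volume.withDensity fun x => V x ^ (-β) := by
  obtain ⟨V, hpos, hV, rfl⟩ := h
  obtain ⟨W, hWm, hW, hVW, hae⟩ := hV.exists_measurable_ae_eq volume
  refine ⟨W, fun x => (hpos x).trans_le (hVW x), hW, hWm, withDensity_congr_ae ?_⟩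
  filter_upwards [hae] with x hx
  rw [hx]

theorem corollary5p2 (β : ℝ) :
    ∃ C : ℝ, 0 < C ∧
      ∀ (n : ℕ), 1 ≤ n → (n : ℝ) < β →
        ∀ (μ : Measure (EuclideanSpace ℝ (Fin n))), IsProbabilityMeasure μ →
          HasConvexPowerDensity β μ →
            Integrable (fun x => Real.log ‖x‖) μ ∧
            ∀ g : EuclideanSpace ℝ (Fin n) → ℝ, ContDiff ℝ ∞ g → (∃ M : ℝ, ∀ x, |g x| ≤ M) →
              ENNReal.ofReal (Var[g; μ]) ≤
                ENNReal.ofReal C *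
                  ∫⁻ x, ENNReal.ofReal (‖∇ g x‖ ^ 2 * (geometricMean μ ^ 2 + ‖x‖ ^ 2)) ∂μ := by
  have hn : ∀ n : ℕ, ∃ C : ℝ, 0 < C ∧ (1 ≤ n → (n : ℝ) < β →
        ∀ (μ : Measure (EuclideanSpace ℝ (Fin n))), IsProbabilityMeasure μ →
          HasConvexPowerDensity β μ →
            Integrable (fun x => Real.log ‖x‖) μ ∧
            ∀ g : EuclideanSpace ℝ (Fin n) → ℝ, ContDiff ℝ ∞ g → (∃ M : ℝ, ∀ x, |g x| ≤ M) →
              ENNReal.ofReal (Var[g; μ]) ≤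
                ENNReal.ofReal C *
                  ∫⁻ x, ENNReal.ofReal (‖∇ g x‖ ^ 2 * (geometricMean μ ^ 2 + ‖x‖ ^ 2)) ∂μ) := by
    intro n
    by_cases hcond : 1 ≤ n ∧ (n : ℝ) < β
    swap
    · exact ⟨1, one_pos, fun h1 h2 => absurd ⟨h1, h2⟩ hcond⟩
    have : Nonempty (Fin n) := ⟨⟨0, hcond.1⟩⟩
    have hβ : (Module.finrank ℝ (EuclideanSpace ℝ (Fin n)) : ℝ) < β := by simpa using hcond.2
    obtain ⟨C, hC, h⟩ := ConvexOn.exists_ofReal_variance_le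
      (volume : Measure (EuclideanSpace ℝ (Fin n))) hβ
    refine ⟨C.toReal + 1, by positivity, fun _ _ μ hμ hd => ?_⟩
    obtain ⟨V, hpos, hV, hm, rfl⟩ := hd.exists_measurable
    have h1 : ∫⁻ x, V x ^ (-β) = 1 := by
      have := hμ.measure_univ
      rwa [withDensity_apply _ MeasurableSet.univ, setLIntegral_univ] at this
    refine ⟨hV.integrable_log_norm hβ hpos hm h1, fun g hg _ => ?_⟩
    have hg1 : ContDiff ℝ 1 g := hg.of_le (by exact_mod_cast le_top)
    have hcg : Continuous (fderiv ℝ g) := hg1.continuous_fderiv (by norm_num)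
    have hgrad : ∀ x, ‖∇ g x‖ = ‖fderiv ℝ g x‖ := fun x => by simp [gradient]
    refine (h V hpos hV hm h1 g (fun x => ‖fderiv ℝ g x‖ₑ) hg1.continuous.measurable
      (by fun_prop) (enorm_sub_le_lintegral_segment hg1)).trans (mul_le_mul' ?_ (le_of_eq ?_))
    · rw [ENNReal.le_ofReal_iff_toReal_le hC (by positivity)]
      linarith
    · simp only [hgrad]
      rw [lintegral_withDensity_eq_lintegral_mul _ (by fun_prop) (by fun_prop)]
      refine lintegral_congr fun x => ?_
      rw [Pi.mul_apply, ENNReal.ofReal_mul (by positivity), ENNReal.ofReal_pow (norm_nonneg _),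
        ofReal_norm, mul_comm]
      rfl
  -- Only finitely many dimensions `n` satisfy `n < β`.
  choose C hC0 hC using hn
  refine ⟨1 + ∑ n ∈ Finset.range ⌈β⌉₊, C n, ?_, fun n h1 hnβ μ hμ hd => ?_⟩
  · have := Finset.sum_nonneg fun n (_ : n ∈ Finset.range ⌈β⌉₊) => (hC0 n).le
    linarith
  obtain ⟨hi, h⟩ := hC n h1 hnβ μ hμ hd
  refine ⟨hi, fun g hg hb => (h g hg hb).trans ?_⟩
  gcongr
  have := Finset.single_le_sum (fun n _ => (hC0 n).le) (Finset.mem_range.2 (Nat.lt_ceil.2 hnβ))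
  linarith
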